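/- Let $d\ge 1$, let $\Omega\subset\mathbb{R}^d$ be a bounded Lipschitz domain, let $s\in(0,1)$ with $s\neq\frac12$, and let $c_{d,s}=\frac{s\,2^{2s}\,\Gamma(s+d/2)}{\pi^{d/2}\,\Gamma(1-s)}$. For $\Omega'=\Omega$ or $\Omega'=\mathbb{R}^d$ let $H^s(\Omega')$ be the space of all $u\in L^2(\Omega')$ with finite norm belonging to the inner product $$(u,v)_{H^s(\Omega')}=\int_{\Omega'}uv\,dx+\frac{c_{d,s}}{2}\int_{\Omega'}\int_{\Omega'}\frac{(u(x)-u(y))(v(x)-v(y))}{|x-y|^{d+2s}}\,dy\,dx .$$ Let $W$ be one of the following Hilbert spaces of functions on $\Omega$: 1. $H^s_0(\Omega)$, the closure of $C_c^\infty(\Omega)$ in $H^s(\Omega)$, with the inner product of $H^s(\Omega)$; 2. $\tilde H^s(\Omega)=\{u\in H^s(\mathbb{R}^d): u=0 \text{ a.e. in } \mathbb{R}^d\setminus\Omega\}$, with the inner product of $H^s(\mathbb{R}^d)$; 3. the spectral space $\mathbb{H}^s(\Omega)=\{w=\sum_n w_n\phi_n\in L^2(\Omega): \sum_n\lambda_n^s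 w_n^2<\infty\}$, $w_n=\int_\Omega w\phi_n\,dx$, with inner product $\sum_n\lambda_n^s u_nv_n$, where $(\phi_n)$ are the $L^2(\Omega)$-orthonormal eigenfunctions of $-\Delta$ on $\Omega$ with zero Dirichlet boundary conditions and $\lambda_n$ are their eigenvalues. Let $F:W\to\mathbb{R}$ be weakly (sequentially) lower semicontinuous, continuously Fréchet differentiable and bounded from below by a continuous affine function, and let $\alpha,\beta>0$. Let $\bar w_0\in W$ be a local minimizer, with respect to the norm of $W$, of $$w\mapsto F(w)+\frac{\alpha}{2}\|w\|_W^2+\beta\int_\Omega|w|^0\,dx,\qquad 0^0:=0,$$ so that $\int_\Omega|w|^0dx$ is the Lebesgue measure of $\{x\in\Omega: w(x)\neq0\}$. Then there is exactly one $\bar\lambda_0\in W^*$ with $$\langle F'(\bar w_0),v\rangle_W+\alpha(\bar w_0,v)_W+\beta\langle\bar\lambda_0,v\rangle_W=0\qquad\text{for all } v\in W,$$ and it satisfies $$\langle\bar\lambda_0,\bar w_0\rangle_W\ge0 .$$ Moreover, for every $\varphi\in C_c^\infty(\Omega)$ with $\varphi\ge0$, the product $\varphi\bar w_0$ belongs to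 $W$ and $$\langle\bar\lambda_0,\varphi\bar w_0\rangle_W\ge0 .$$ -/

import Mathlib

open MeasureTheory Set Filter
open scoped ContDiff Topology RealInnerProductSpace

noncomputable section

namespace FracSob

/-- Euclidean space `ℝ^d`. -/
abbrev E (d : ℕ) : Type := EuclideanSpace ℝ (Fin d)

/-- The real Hilbert space `L²(Ω)`. -/
abbrev L2 {d : ℕ} (Ω : Set (E d)) : Type := Lp ℝ 2 ((volume : Measure (E d)).restrict Ω)

/-- Vector fields on `Ω` with components in `L²(Ω)`. -/
abbrev L2Vec {d : ℕ} (Ω : Set (E d)) : Type := Lp (E d) 2 ((volume : Measure (E d)).restrict Ω)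

/-- Bounded Lipschitz domains: bounded open sets which, near every boundary point and in suitable
Cartesian coordinates, are the strict epigraph of a Lipschitz function of the coordinates orthogonal
to a unit vector `n`. Connectedness is not required. -/
structure IsBoundedLipschitzDomain {d : ℕ} (Ω : Set (E d)) : Prop where
  isOpen : IsOpen Ω
  isBounded : Bornology.IsBounded Ω
  lipschitz_boundary : ∀ z ∈ frontier Ω, ∃ r > 0, ∃ n : E d, ‖n‖ = 1 ∧
    ∃ (K : NNReal) (g : E d → ℝ), LipschitzWith K g ∧
      ∀ x ∈ Metric.ball z r, x ∈ Ω ↔ g (x - ⟪n, x⟫ • n) < ⟪n, x⟫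

/-- `φ ∈ C_c^∞(Ω)`, as a function on `ℝ^d` that vanishes outside its compact support in `Ω`. -/
structure IsTestFunction {d : ℕ} (Ω : Set (E d)) (φ : E d → ℝ) : Prop where
  smooth : ContDiff ℝ ∞ φ
  compact : HasCompactSupport φ
  support_subset : tsupport φ ⊆ Ω

/-! ### Integral fractional Sobolev spaces -/

/-- The constant `c_{d,s}`. -/
def fracConst (d : ℕ) (s : ℝ) : ℝ :=
  s * (2 : ℝ) ^ (2 * s) * Real.Gamma (s + d / 2) / (Real.pi ^ ((d : ℝ) / 2) * Real.Gamma (1 - s))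

/-- The measure `(c_{d,s} / 2) |x - y|^{-(d + 2s)} dx dy` on `Ω × Ω`. -/
def gagliardo {d : ℕ} (Ω : Set (E d)) (s : ℝ) : Measure (E d × E d) :=
  (((volume : Measure (E d)).restrict Ω).prod ((volume : Measure (E d)).restrict Ω)).withDensity
    fun p => ENNReal.ofReal (fracConst d s / 2 / ‖p.1 - p.2‖ ^ ((d : ℝ) + 2 * s))

theorem ae_gagliardo_of_ae {d : ℕ} {Ω : Set (E d)} (s : ℝ) {P : E d → Prop}
    (h : ∀ᵐ x ∂((volume : Measure (E d)).restrict Ω), P x) :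
    ∀ᵐ p ∂(gagliardo Ω s), P p.1 ∧ P p.2 := by
  refine (withDensity_absolutelyContinuous _ _).ae_le ?_
  exact (Measure.quasiMeasurePreserving_fst.ae h).and (Measure.quasiMeasurePreserving_snd.ae h)

/-- The space `H^s(Ω)`. An element is a pair `(u, U)` with `u ∈ L²(Ω)`, `U(x, y) = u(x) - u(y)`, and
`U` square integrable for the measure `(c_{d,s} / 2) |x - y|^{-(d + 2s)} dx dy` on `Ω × Ω`;
`U` is determined by `u`. The inner product inherited from the Hilbert sum is
`∫_Ω u v dx + (c_{d,s} / 2) ∫_Ω ∫_Ω (u(x) - u(y)) (v(x) - v(y)) / |x - y|^{d + 2s} dy dx`. -/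
def Hs {d : ℕ} (Ω : Set (E d)) (s : ℝ) :
    Submodule ℝ (WithLp 2 (L2 Ω × Lp ℝ 2 (gagliardo Ω s))) where
  carrier := {p | ∀ᵐ z ∂(gagliardo Ω s), p.snd z = p.fst z.1 - p.fst z.2}
  zero_mem' := by
    filter_upwards [Lp.coeFn_zero ℝ 2 (gagliardo Ω s), ae_gagliardo_of_ae s
      (Lp.coeFn_zero ℝ 2 ((volume : Measure (E d)).restrict Ω))] with z h1 h2
    change (0 : Lp ℝ 2 (gagliardo Ω s)) z = (0 : L2 Ω) z.1 - (0 : L2 Ω) z.2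
    rw [h1, h2.1, h2.2]
    simp
  add_mem' := by
    intro p q hp hq
    filter_upwards [hp, hq, Lp.coeFn_add p.snd q.snd,
      ae_gagliardo_of_ae s (Lp.coeFn_add p.fst q.fst)] with z h1 h2 h3 h4
    simp only [WithLp.add_fst, WithLp.add_snd]
    rw [h3, h4.1, h4.2]
    simp only [Pi.add_apply, h1, h2]
    ring
  smul_mem' := by
    intro c p hp
    filter_upwards [hp, Lp.coeFn_smul c p.snd,
      ae_gagliardo_of_ae s (Lp.coeFn_smul c p.fst)] with z h1 h3 h4
    simp only [WithLp.smul_fst, WithLp.smul_snd]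
    rw [h3, h4.1, h4.2]
    simp only [Pi.smul_apply, h1, smul_eq_mul]
    ring

/-- `H_0^s(Ω)`, the closure of `C_c^∞(Ω)` in `H^s(Ω)`, with the inner product of `H^s(Ω)`. -/
def H0s {d : ℕ} (Ω : Set (E d)) (s : ℝ) : Submodule ℝ (Hs Ω s) :=
  (Submodule.span ℝ {u : Hs Ω s | ∃ φ : E d → ℝ, IsTestFunction Ω φ ∧
    u.1.fst =ᵐ[(volume : Measure (E d)).restrict Ω] φ}).topologicalClosure

/-- The space of all `u ∈ H^s(ℝ^d)` that vanish almost everywhere outside `Ω`, with the inner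
product of `H^s(ℝ^d)`. -/
def HTilde {d : ℕ} (Ω : Set (E d)) (s : ℝ) : Submodule ℝ (Hs (univ : Set (E d)) s) where
  carrier := {u | ∀ᵐ x ∂((volume : Measure (E d)).restrict univ), x ∉ Ω → u.1.fst x = 0}
  zero_mem' := by
    filter_upwards [Lp.coeFn_zero ℝ 2 ((volume : Measure (E d)).restrict univ)] with x h _
    exact h
  add_mem' := by
    intro u v hu hv
    filter_upwards [hu, hv, Lp.coeFn_add u.1.fst v.1.fst] with x h1 h2 h3 hx
    have : (u + v).1.fst = u.1.fst + v.1.fst := rfl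
    rw [this, h3, Pi.add_apply, h1 hx, h2 hx, add_zero]
  smul_mem' := by
    intro c u hu
    filter_upwards [hu, Lp.coeFn_smul c u.1.fst] with x h1 h3 hx
    have : (c • u).1.fst = c • u.1.fst := rfl
    rw [this, h3, Pi.smul_apply, h1 hx, smul_zero]

/-! ### The spectral fractional Sobolev space -/

/-- `H_0^1(Ω)`, as the closure of the pairs `(φ, ∇φ)`, `φ ∈ C_c^∞(Ω)`, in `L²(Ω) × L²(Ω)^d`: its
elements are the pairs `(u, ∇u)`. -/
def H10 {d : ℕ} (Ω : Set (E d)) : Submodule ℝ (WithLp 2 (L2 Ω × L2Vec Ω)) :=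
  (Submodule.span ℝ {p : WithLp 2 (L2 Ω × L2Vec Ω) | ∃ φ : E d → ℝ, IsTestFunction Ω φ ∧
    p.fst =ᵐ[(volume : Measure (E d)).restrict Ω] φ ∧
    p.snd =ᵐ[(volume : Measure (E d)).restrict Ω] gradient φ}).topologicalClosure

/-- `u ≠ 0` is an eigenfunction of `-Δ` on `Ω` with zero Dirichlet boundary conditions, in the weak
sense, for the (necessarily positive) eigenvalue `μ`: `u ∈ H_0^1(Ω)` and
`∫_Ω ∇u · ∇v dx = μ ∫_Ω u v dx` for all `v ∈ H_0^1(Ω)`. -/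
def IsDirichletEigenfunction {d : ℕ} (Ω : Set (E d)) (μ : ℝ) (u : L2 Ω) : Prop :=
  u ≠ 0 ∧ 0 < μ ∧ ∃ p ∈ H10 Ω, p.fst = u ∧ ∀ q ∈ H10 Ω, ⟪p.snd, q.snd⟫ = μ * ⟪p.fst, q.fst⟫

/-- The orthonormal Dirichlet eigenfunctions `φ_n` of a domain with their eigenvalues, repeated
according to multiplicity. That the list is exhaustive is expressed by maximality: no eigenfunction
is orthogonal to all the `φ_n`. -/
structure DirichletEigensystem {d : ℕ} (Ω : Set (E d)) (ι : Type) where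
  fn : ι → L2 Ω
  ev : ι → ℝ
  orthonormal : Orthonormal ℝ fn
  eigen : ∀ n, IsDirichletEigenfunction Ω (ev n) (fn n)
  maximal : ∀ μ u, IsDirichletEigenfunction Ω μ u → ∃ n, ⟪fn n, u⟫ ≠ 0

/-- A (maximal) eigensystem exists. -/
theorem exists_dirichletEigensystem {d : ℕ} (Ω : Set (E d)) :
    ∃ ι : Type, Nonempty (DirichletEigensystem Ω ι) := by
  obtain ⟨A, hA⟩ := zorn_subset
    {A : Set (L2 Ω) | Orthonormal ℝ ((↑) : A → L2 Ω) ∧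
      ∀ u ∈ A, ∃ μ, IsDirichletEigenfunction Ω μ u} (by
    intro c hc hchain
    refine ⟨⋃₀ c, ⟨orthonormal_sUnion_of_directed hchain.directedOn fun a ha => (hc ha).1, ?_⟩,
      fun a ha => subset_sUnion_of_mem ha⟩
    rintro u ⟨a, ha, hu⟩
    exact (hc ha).2 u hu)
  choose ev hev using fun n : A => hA.prop.2 n n.2
  refine ⟨A, ⟨⟨fun n => n, ev, hA.prop.1, hev, ?_⟩⟩⟩
  rintro μ u ⟨hu0, hμ, p, hp, hpu, hpq⟩
  by_contra! hperp
  have hn : ‖u‖ ≠ 0 := norm_ne_zero_iff.2 hu0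
  set e : L2 Ω := ‖u‖⁻¹ • u with he
  have he1 : ‖e‖ = 1 := by rw [he, norm_smul, norm_inv, norm_norm, inv_mul_cancel₀ hn]
  have heA : ∀ v ∈ A, ⟪v, e⟫ = 0 := fun v hv => by
    rw [he, inner_smul_right, hperp ⟨v, hv⟩, mul_zero]
  have hins : insert e A ∈ {A : Set (L2 Ω) | Orthonormal ℝ ((↑) : A → L2 Ω) ∧
      ∀ u ∈ A, ∃ μ, IsDirichletEigenfunction Ω μ u} := by
    refine ⟨⟨?_, ?_⟩, ?_⟩
    · rintro ⟨v, rfl | hv⟩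
      · exact he1
      · exact hA.prop.1.1 ⟨v, hv⟩
    · rintro ⟨v, rfl | hv⟩ ⟨w, rfl | hw⟩ hvw
      · exact absurd rfl hvw
      · exact (real_inner_comm _ _).trans (heA w hw)
      · exact heA v hv
      · exact hA.prop.1.2 (i := ⟨v, hv⟩) (j := ⟨w, hw⟩) fun h =>
          hvw (Subtype.ext (congrArg Subtype.val h :))
    · rintro v (rfl | hv)
      · refine ⟨μ, smul_ne_zero (inv_ne_zero hn) hu0, hμ, ‖u‖⁻¹ • p,
          (H10 Ω).smul_mem _ hp, by rw [WithLp.smul_fst, hpu], fun q hq => ?_⟩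
        rw [WithLp.smul_fst, WithLp.smul_snd, inner_smul_left, inner_smul_left, hpq q hq]
        ring
      · exact hA.prop.2 v hv
  have heq := heA e (hA.le_of_ge hins (subset_insert e A) (mem_insert e A))
  rw [real_inner_self_eq_norm_sq, he1] at heq
  norm_num at heq

/-- The functions `w = ∑ₙ wₙ φ_n ∈ L²(Ω)`, `wₙ = ∫_Ω w φ_n dx`, with `∑ₙ λ_n^s wₙ² < ∞`. -/
def specSubmodule {d : ℕ} {Ω : Set (E d)} {ι : Type} (S : DirichletEigensystem Ω ι) (s : ℝ) :
    Submodule ℝ (L2 Ω) where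
  carrier := {w | HasSum (fun n => ⟪S.fn n, w⟫ • S.fn n) w ∧
    Summable fun n => S.ev n ^ s * ⟪S.fn n, w⟫ ^ 2}
  zero_mem' := by simp [hasSum_zero, summable_zero]
  add_mem' := by
    rintro u v ⟨hu, hu'⟩ ⟨hv, hv'⟩
    refine ⟨by simpa only [inner_add_right, add_smul] using hu.add hv, ?_⟩
    refine Summable.of_nonneg_of_le (fun n => ?_) (fun n => ?_)
      ((hu'.mul_left 2).add (hv'.mul_left 2))
    · have := Real.rpow_nonneg (S.eigen n).2.1.le s
      positivity
    · have := Real.rpow_nonneg (S.eigen n).2.1.le s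
      rw [inner_add_right]
      nlinarith [mul_nonneg this (sq_nonneg (⟪S.fn n, u⟫ - ⟪S.fn n, v⟫))]
  smul_mem' := by
    rintro c u ⟨hu, hu'⟩
    refine ⟨by simpa only [inner_smul_right, mul_smul, RCLike.ofReal_real_eq_id, id_eq]
      using hu.const_smul c, ?_⟩
    refine (hu'.mul_left (c ^ 2)).congr fun n => ?_
    simp only [inner_smul_right]
    ring

/-- The spectral fractional Sobolev space, with inner product `∑ₙ λ_n^s uₙ vₙ`. -/
def HSpec {d : ℕ} {Ω : Set (E d)} {ι : Type} (S : DirichletEigensystem Ω ι) (s : ℝ) : Type :=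
  specSubmodule S s

namespace HSpec

variable {d : ℕ} {Ω : Set (E d)} {ι : Type} (S : DirichletEigensystem Ω ι) (s : ℝ)

instance : AddCommGroup (HSpec S s) := inferInstanceAs (AddCommGroup (specSubmodule S s))

instance : Module ℝ (HSpec S s) := inferInstanceAs (Module ℝ (specSubmodule S s))

/-- The underlying function in `L²(Ω)`. -/
def toL2 : HSpec S s →ₗ[ℝ] L2 Ω := (specSubmodule S s).subtype

theorem summable_inner (u v : HSpec S s) :
    Summable fun n => S.ev n ^ s * (⟪S.fn n, toL2 S s u⟫ * ⟪S.fn n, toL2 S s v⟫) := by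
  have hu : Summable fun n => S.ev n ^ s * ⟪S.fn n, toL2 S s u⟫ ^ 2 := u.2.2
  have hv : Summable fun n => S.ev n ^ s * ⟪S.fn n, toL2 S s v⟫ ^ 2 := v.2.2
  refine Summable.of_norm_bounded (hu.add hv) fun n => ?_
  have h := Real.rpow_nonneg (S.eigen n).2.1.le s
  rw [Real.norm_eq_abs, abs_mul, abs_of_nonneg h, ← mul_add]
  refine mul_le_mul_of_nonneg_left ?_ h
  rw [abs_le]
  constructor <;> nlinarith [sq_nonneg (⟪S.fn n, toL2 S s u⟫ - ⟪S.fn n, toL2 S s v⟫),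
    sq_nonneg (⟪S.fn n, toL2 S s u⟫ + ⟪S.fn n, toL2 S s v⟫),
    sq_nonneg ⟪S.fn n, toL2 S s u⟫, sq_nonneg ⟪S.fn n, toL2 S s v⟫]

/-- The inner product of the spectral fractional Sobolev space. -/
@[reducible]
def core : InnerProductSpace.Core ℝ (HSpec S s) where
  inner u v := ∑' n, S.ev n ^ s * (⟪S.fn n, toL2 S s u⟫ * ⟪S.fn n, toL2 S s v⟫)
  conj_inner_symm u v := by
    simp only [conj_trivial]
    exact tsum_congr fun n => by ring
  re_inner_nonneg u := by
    simp only [RCLike.re_to_real]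
    exact tsum_nonneg fun n =>
      mul_nonneg (Real.rpow_nonneg (S.eigen n).2.1.le s) (mul_self_nonneg _)
  add_left u v w := by
    rw [← (summable_inner S s u w).tsum_add (summable_inner S s v w)]
    exact tsum_congr fun n => by
      rw [map_add, inner_add_right]
      ring
  smul_left u v c := by
    simp only [conj_trivial]
    rw [← tsum_mul_left]
    exact tsum_congr fun n => by
      rw [map_smul, inner_smul_right]
      ring
  definite u hu := by
    have h0 := (hasSum_zero_iff_of_nonneg (fun n =>
      mul_nonneg (Real.rpow_nonneg (S.eigen n).2.1.le s) (mul_self_nonneg _))).1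
      (hu ▸ (summable_inner S s u u).hasSum)
    have h1 : ∀ n, ⟪S.fn n, toL2 S s u⟫ = 0 := fun n => by
      have := congrFun h0 n
      simpa [(Real.rpow_pos_of_pos (S.eigen n).2.1 s).ne'] using this
    have h2 : HasSum (fun n => ⟪S.fn n, toL2 S s u⟫ • S.fn n) (toL2 S s u) := u.2.1
    simp only [h1, zero_smul] at h2
    exact Subtype.ext (h2.unique hasSum_zero)

instance : NormedAddCommGroup (HSpec S s) := (core S s).toNormedAddCommGroup

instance : InnerProductSpace ℝ (HSpec S s) := InnerProductSpace.ofCore (core S s).toCore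

end HSpec

/-! ### The Hilbert space `W` -/

/-- The admissible choices of the inner product of `W`: that of `H^s(Ω)`, that of `H^s(ℝ^d)`
(for functions extended by zero), or the spectral one. -/
inductive InnerChoice {d : ℕ} (Ω : Set (E d)) : Type 1
  | integral : InnerChoice Ω
  | global : InnerChoice Ω
  | spectral (ι : Type) (S : DirichletEigensystem Ω ι) : InnerChoice Ω

/-- The space `W`: one of `H_0^s(Ω)`, `H̃^s(Ω)`, `ℍ^s(Ω)` with its own inner product. -/
def W {d : ℕ} {Ω : Set (E d)} (s : ℝ) : InnerChoice Ω → Type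
  | .integral => H0s Ω s
  | .global => HTilde Ω s
  | .spectral _ S => HSpec S s

namespace W

variable {d : ℕ} {Ω : Set (E d)} (s : ℝ)

instance : (k : InnerChoice Ω) → NormedAddCommGroup (W s k)
  | .integral => inferInstanceAs (NormedAddCommGroup (H0s Ω s))
  | .global => inferInstanceAs (NormedAddCommGroup (HTilde Ω s))
  | .spectral _ S => inferInstanceAs (NormedAddCommGroup (HSpec S s))

instance : (k : InnerChoice Ω) → InnerProductSpace ℝ (W s k)
  | .integral => inferInstanceAs (InnerProductSpace ℝ (H0s Ω s))
  | .global => inferInstanceAs (InnerProductSpace ℝ (HTilde Ω s))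
  | .spectral _ S => inferInstanceAs (InnerProductSpace ℝ (HSpec S s))

/-- A function representing an element of `W`; only its values on `Ω`, up to null sets, matter. -/
def toFun {s : ℝ} : {k : InnerChoice Ω} → W s k → E d → ℝ
  | .integral => fun w : H0s Ω s => w.1.1.fst
  | .global => fun w : HTilde Ω s => w.1.1.fst
  | .spectral _ S => fun w : HSpec S s => HSpec.toL2 S s w

end W

/-! ### The optimization problem -/

/-- Sequential weak lower semicontinuity: `F w ≤ liminf F (u k)` whenever `u k ⇀ w`. -/
def WeaklyLSC {V : Type} [NormedAddCommGroup V] [InnerProductSpace ℝ V] (F : V → ℝ) : Prop :=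
  ∀ (u : ℕ → V) (w : V), (∀ g : V →L[ℝ] ℝ, Tendsto (fun k => g (u k)) atTop (𝓝 (g w))) →
    ∀ c < F w, ∀ᶠ k in atTop, c < F (u k)

/-- The standing assumptions on `F`. -/
structure Admissible {V : Type} [NormedAddCommGroup V] [InnerProductSpace ℝ V] (F : V → ℝ) :
    Prop where
  weaklyLSC : WeaklyLSC F
  affine_bound : ∃ (g : V →L[ℝ] ℝ) (c : ℝ), ∀ w, g w + c ≤ F w
  contDiff : ContDiff ℝ 1 F

/-- `|t|^0` with the convention `0^0 = 0`. -/
def absPowZero (t : ℝ) : ℝ := if t = 0 then 0 else 1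

/-- The objective `F(w) + (α/2) ‖w‖_W² + β ∫_Ω |w|^0 dx`. -/
def objective {d : ℕ} {Ω : Set (E d)} {s : ℝ} {k : InnerChoice Ω} (F : W s k → ℝ) (α β : ℝ)
    (w : W s k) : ℝ :=
  F w + α / 2 * ‖w‖ ^ 2 + β * ∫ x in Ω, absPowZero (w.toFun x)

/-- The equation `⟨F'(w), v⟩ + α (w, v)_W + β ⟨lam, v⟩ = 0` for all `v ∈ W`, defining the
multiplier `lam ∈ W*`. -/
def IsMultiplier {V : Type} [NormedAddCommGroup V] [InnerProductSpace ℝ V] (F : V → ℝ) (α β : ℝ)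
    (w : V) (lam : V →L[ℝ] ℝ) : Prop :=
  ∀ v : V, fderiv ℝ F w v + α * ⟪w, v⟫ + β * lam v = 0

end FracSob

end

noncomputable section

namespace FracSob

/-! ### Bounded operators between `L²` spaces -/

/-! For bounded `g` with `g w₀ ∈ W`, the perturbation `w₀ + t g w₀ = (1 + t g) w₀` has the same zero
set as `w₀` once `|t|` is small. The measure term is then constant along this line, so the
differentiable part `F + (α/2)‖·‖²` has a local minimum at `t = 0` and its derivative there
vanishes. By the equation defining it, the multiplier vanishes on `g w₀`
(`IsMultiplier.apply_eq_zero`); `g = 1` and `g = φ` give both inequalities, as equalities. Existence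
and uniqueness of the multiplier only require solving its equation for it.

The real work is to show `φ w₀ ∈ W` (`W.exists_mul_testFunction`). In the two integral spaces, the
difference of `φ u` splits into `φ(x)(u(x) - u(y))` plus the commutator `(φ(x) - φ(y)) u(y)`, which
is controlled by an integrable convolution kernel (`exists_mul_Hs`).

In the spectral space, multiplication by `φ` is bounded on `L²` and on `H_0^1`, and one
interpolates: `λ^s` is a weighted integral over `t` of `λ/(t + λ)`, and the form with these weights
is, up to the factor `t`, the least energy `‖∇a‖² + t‖b‖²` over splittings `u = a + b`
(`exists_interpolation_bound`). That `φ w` has an eigenfunction expansion at all is completeness of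
the eigenfunctions. It follows from maximality of the system by the spectral theorem for the compact
resolvent, compactness being Rellich's theorem. -/

theorem eLpNorm_two_sq {α F : Type*} [MeasurableSpace α] [NormedAddCommGroup F] (μ : Measure α)
    (f : α → F) : eLpNorm f 2 μ ^ 2 = ∫⁻ x, ‖f x‖ₑ ^ 2 ∂μ := by
  have h := eLpNorm_nnreal_pow_eq_lintegral (f := f) (μ := μ) (p := 2) (by norm_num)
  simpa using h

theorem ofReal_norm_sq_Lp {α F : Type*} [MeasurableSpace α] [NormedAddCommGroup F]
    {μ : Measure α} (f : Lp F 2 μ) : ENNReal.ofReal (‖f‖ ^ 2) = ∫⁻ x, ‖f x‖ₑ ^ 2 ∂μ := by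
  rw [← eLpNorm_two_sq, ENNReal.ofReal_pow (norm_nonneg _), Lp.norm_def,
    ENNReal.ofReal_toReal (Lp.eLpNorm_ne_top f)]

/-- A weighted composition operator `f ↦ (z ↦ B z (f (π z)))` which is bounded in the `L²` sense
defines a continuous linear map between the `L²` spaces. -/
theorem exists_weightedComp_Lp {α β F G : Type*} [MeasurableSpace α] [MeasurableSpace β]
    [NormedAddCommGroup F] [NormedSpace ℝ F] [NormedAddCommGroup G] [NormedSpace ℝ G]
    {μ : Measure α} {ν : Measure β} (B : β → F →L[ℝ] G) (π : β → α)
    (hπ : Measure.QuasiMeasurePreserving π ν μ)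
    (hm : ∀ f : α → F, StronglyMeasurable f → AEStronglyMeasurable (fun z => B z (f (π z))) ν)
    (K : ENNReal) (hK : K ≠ ⊤)
    (hB : ∀ f : α → F, StronglyMeasurable f →
      ∫⁻ z, ‖B z (f (π z))‖ₑ ^ 2 ∂ν ≤ K * ∫⁻ x, ‖f x‖ₑ ^ 2 ∂μ) :
    ∃ A : Lp F 2 μ →L[ℝ] Lp G 2 ν, ∀ f, A f =ᵐ[ν] fun z => B z (f (π z)) := by
  have hmem : ∀ f : Lp F 2 μ, MemLp (fun z => B z (f (π z))) 2 ν := fun f => by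
    refine ⟨hm f (Lp.stronglyMeasurable f), ?_⟩
    have h : eLpNorm (fun z => B z (f (π z))) 2 ν ^ 2 < ⊤ := by
      rw [eLpNorm_two_sq]
      refine (hB f (Lp.stronglyMeasurable f)).trans_lt ?_
      rw [← ofReal_norm_sq_Lp]
      exact ENNReal.mul_lt_top hK.lt_top ENNReal.ofReal_lt_top
    exact (ENNReal.pow_lt_top_iff.1 h).resolve_right (by norm_num)
  -- Since `π` is quasi-measure-preserving, a.e. identities for `f` pull back along `π`; this gives
  -- linearity on classes.
  let A₀ : Lp F 2 μ →ₗ[ℝ] Lp G 2 ν :=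
    { toFun := fun f => (hmem f).toLp _
      map_add' := fun f g => by
        rw [← MemLp.toLp_add]
        refine MemLp.toLp_congr _ _ ?_
        filter_upwards [hπ.ae (Lp.coeFn_add f g)] with z hz
        rw [hz]
        simp
      map_smul' := fun c f => by
        rw [RingHom.id_apply, ← MemLp.toLp_const_smul]
        refine MemLp.toLp_congr _ _ ?_
        filter_upwards [hπ.ae (Lp.coeFn_smul c f)] with z hz
        rw [hz]
        simp }
  have hA : ∀ f, A₀ f =ᵐ[ν] fun z => B z (f (π z)) := fun f => (hmem f).coeFn_toLp
  refine ⟨A₀.mkContinuous (Real.sqrt K.toReal) fun f => ?_, hA⟩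
  refine abs_le_of_sq_le_sq' ?_ (by positivity) |>.2
  rw [mul_pow, Real.sq_sqrt ENNReal.toReal_nonneg]
  refine (ENNReal.ofReal_le_ofReal_iff (by positivity)).1 ?_
  rw [ENNReal.ofReal_mul ENNReal.toReal_nonneg, ENNReal.ofReal_toReal hK, ofReal_norm_sq_Lp,
    ofReal_norm_sq_Lp]
  refine le_trans (le_of_eq ?_) (hB f (Lp.stronglyMeasurable f))
  refine lintegral_congr_ae ?_
  filter_upwards [hA f] with z hz
  rw [hz]

/-- Multiplication by a bounded operator-valued function. -/
theorem exists_mul_Lp {α F G : Type*} [MeasurableSpace α]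
    [NormedAddCommGroup F] [NormedSpace ℝ F] [NormedAddCommGroup G] [NormedSpace ℝ G]
    (μ : Measure α) (B : α → F →L[ℝ] G) (hm : StronglyMeasurable B)
    (C : ℝ) (hB : ∀ z, ‖B z‖ ≤ C) :
    ∃ A : Lp F 2 μ →L[ℝ] Lp G 2 μ, ∀ f, A f =ᵐ[μ] fun z => B z (f z) := by
  refine exists_weightedComp_Lp B id (Measure.QuasiMeasurePreserving.id μ) ?_
    (ENNReal.ofReal (C ^ 2)) ENNReal.ofReal_ne_top ?_
  · intro f hf
    exact (isBoundedBilinearMap_apply.continuous.comp_stronglyMeasurable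
      (hm.prodMk hf)).aestronglyMeasurable
  · intro f hf
    rw [← lintegral_const_mul' _ _ ENNReal.ofReal_ne_top]
    refine lintegral_mono fun z => ?_
    simp only [id]
    rw [← ofReal_norm, ← ofReal_norm, ← ENNReal.ofReal_pow (norm_nonneg _),
      ← ENNReal.ofReal_pow (norm_nonneg _), ← ENNReal.ofReal_mul (by positivity), ← mul_pow]
    refine ENNReal.ofReal_le_ofReal (pow_le_pow_left₀ (norm_nonneg _) ?_ 2)
    exact ((B z).le_opNorm _).trans (mul_le_mul_of_nonneg_right (hB z) (norm_nonneg _))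

/-- `H0s` and `H10` are closures of spans of test functions; this reduces their invariance under
multiplication by `φ` to products of two test functions. -/
theorem map_mem_topologicalClosure_span {V : Type*} [NormedAddCommGroup V] [NormedSpace ℝ V]
    (M : V →L[ℝ] V) {S : Set V} (hS : ∀ u ∈ S, M u ∈ S) {u : V}
    (hu : u ∈ (Submodule.span ℝ S).topologicalClosure) :
    M u ∈ (Submodule.span ℝ S).topologicalClosure := by
  refine map_mem_closure (s := (Submodule.span ℝ S : Set V)) M.continuous hu fun w hw => ?_
  induction hw using Submodule.span_induction with
  | mem w hw => exact Submodule.subset_span (hS w hw)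
  | zero => rw [map_zero]; exact Submodule.zero_mem _
  | add v w _ _ hv hw => rw [map_add]; exact Submodule.add_mem _ hv hw
  | smul c v _ hv => rw [map_smul]; exact Submodule.smul_mem _ c hv

/-! ### Test functions -/

theorem IsTestFunction.exists_bound {d : ℕ} {Ω : Set (E d)} {φ : E d → ℝ}
    (hφ : IsTestFunction Ω φ) : ∃ C, ∀ x, ‖φ x‖ ≤ C :=
  hφ.compact.exists_bound_of_continuous hφ.smooth.continuous

theorem IsTestFunction.exists_lipschitz {d : ℕ} {Ω : Set (E d)} {φ : E d → ℝ}
    (hφ : IsTestFunction Ω φ) : ∃ L : NNReal, LipschitzWith L φ :=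
  (hφ.smooth.of_le (by simp : (1 : ℕ∞ω) ≤ ∞)).lipschitzWith_of_hasCompactSupport hφ.compact
    one_ne_zero

theorem IsTestFunction.mul {d : ℕ} {Ω : Set (E d)} {φ ψ : E d → ℝ}
    (hφ : IsTestFunction Ω φ) (hψ : IsTestFunction Ω ψ) :
    IsTestFunction Ω fun x => φ x * ψ x :=
  ⟨hφ.smooth.mul hψ.smooth, hφ.compact.mul_right,
    (tsupport_mul_subset_left).trans hφ.support_subset⟩

/-! ### Multiplication by test functions in the integral spaces -/

/-- The kernel `min (A², L² |z|²) |z|^{-(d + 2s)}` is integrable. -/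
theorem integrable_min_kernel {d : ℕ} (hd : 0 < d) {s : ℝ} (hs : s ∈ Ioo (0 : ℝ) 1) (A L κ : ℝ)
    (hκ : 0 ≤ κ) :
    Integrable fun z : E d => min (A ^ 2) (L ^ 2 * ‖z‖ ^ 2) * (κ / ‖z‖ ^ ((d : ℝ) + 2 * s)) := by
  have hmeas : AEStronglyMeasurable (fun z : E d =>
      min (A ^ 2) (L ^ 2 * ‖z‖ ^ 2) * (κ / ‖z‖ ^ ((d : ℝ) + 2 * s))) volume := by
    refine Measurable.aestronglyMeasurable ?_
    fun_prop
  have hfin : Module.finrank ℝ (E d) = d := by simp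
  have hd' : (0 : ℝ) < d := by exact_mod_cast hd
  obtain ⟨hs0, hs1⟩ := hs
  rw [← integrableOn_univ, ← union_compl_self (Metric.ball (0 : E d) 1)]
  refine IntegrableOn.union ?_ ?_
  -- Near the origin the factor `‖z‖²` lowers the singularity to order `d + 2s - 2 < d`, because `s
  -- < 1`.
  · refine integrableOn_ball_of_norm_le_rpow (C := L ^ 2 * κ) (α := d + 2 * s - 2)
      (by rw [hfin]; exact hd) (by rw [hfin]; linarith) (ae_of_all _ fun z => ?_) hmeas
    rw [Real.norm_of_nonneg (by positivity)]
    -- At the origin the kernel takes the default value of division by zero, namely `0`.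
    rcases eq_or_ne z 0 with rfl | hz
    · have h1 : ‖(0 : E d)‖ ^ ((d : ℝ) + 2 * s) = 0 := by
        rw [norm_zero, Real.zero_rpow (by positivity)]
      rw [h1]
      simp only [div_zero, mul_zero]
      positivity
    · have hz' : 0 < ‖z‖ := norm_pos_iff.2 hz
      have h2 : ‖z‖ ^ (-((d : ℝ) + 2 * s - 2)) = ‖z‖ ^ 2 / ‖z‖ ^ ((d : ℝ) + 2 * s) := by
        rw [neg_sub, Real.rpow_sub hz']
        norm_num
      rw [h2]
      refine (mul_le_mul_of_nonneg_right (min_le_right _ _) (by positivity)).trans (le_of_eq ?_)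
      ring
  -- Away from the origin the bounded factor suffices: the decay exponent `d + 2s` exceeds `d`,
  -- because `s > 0`.
  · have hint := (integrable_one_add_norm (E := E d) (μ := volume) (r := d + 2 * s)
      (by rw [hfin]; linarith)).const_mul (A ^ 2 * κ * 2 ^ ((d : ℝ) + 2 * s))
    refine Integrable.mono' hint.integrableOn hmeas.restrict ?_
    filter_upwards [ae_restrict_mem Metric.isOpen_ball.measurableSet.compl] with z hz
    have hz1 : 1 ≤ ‖z‖ := by simpa using hz
    rw [Real.norm_of_nonneg (by positivity)]
    have h3 : (1 + ‖z‖) ^ ((d : ℝ) + 2 * s) ≤ 2 ^ ((d : ℝ) + 2 * s) * ‖z‖ ^ ((d : ℝ) + 2 * s) := by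
      rw [← Real.mul_rpow (by norm_num) (by positivity)]
      exact Real.rpow_le_rpow (by positivity) (by linarith) (by positivity)
    calc _ ≤ A ^ 2 * (κ / ‖z‖ ^ ((d : ℝ) + 2 * s)) :=
          mul_le_mul_of_nonneg_right (min_le_left _ _) (by positivity)
      _ = A ^ 2 * κ * (‖z‖ ^ ((d : ℝ) + 2 * s))⁻¹ := by ring
      _ ≤ A ^ 2 * κ * (2 ^ ((d : ℝ) + 2 * s) * ((1 + ‖z‖) ^ ((d : ℝ) + 2 * s))⁻¹) := by
          refine mul_le_mul_of_nonneg_left ?_ (by positivity)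
          rw [← div_eq_mul_inv, inv_le_comm₀ (by positivity) (by positivity), inv_div,
            div_le_iff₀' (by positivity)]
          exact h3
      _ = _ := by rw [Real.rpow_neg (by positivity)]; ring

/-- The commutator term: `u ↦ (φ(x) - φ(y)) u(y)` is bounded from `L²` to the weighted `L²`
space on pairs. -/
theorem exists_commutator_gagliardo {d : ℕ} (hd : 0 < d) {s : ℝ} (hs : s ∈ Ioo (0 : ℝ) 1)
    (Ω : Set (E d)) {Ω' : Set (E d)} {φ : E d → ℝ} (hφ : IsTestFunction Ω' φ) :
    ∃ A : L2 Ω →L[ℝ] Lp ℝ 2 (gagliardo Ω s),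
      ∀ f, A f =ᵐ[gagliardo Ω s] fun z => (φ z.1 - φ z.2) * f z.2 := by
  obtain ⟨C, hC⟩ := hφ.exists_bound
  obtain ⟨L, hL⟩ := hφ.exists_lipschitz
  have hφm : Measurable φ := hφ.smooth.continuous.measurable
  -- The absolute value gives a nonnegative majorant without discussing the sign of the constant.
  set κ := |fracConst d s / 2|
  let h : E d → ℝ := fun z => min ((2 * C) ^ 2) ((L : ℝ) ^ 2 * ‖z‖ ^ 2) *
    (κ / ‖z‖ ^ ((d : ℝ) + 2 * s))
  have hh : Integrable h := integrable_min_kernel hd hs (2 * C) L κ (abs_nonneg _)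
  refine exists_weightedComp_Lp (μ := (volume : Measure (E d)).restrict Ω)
    (ν := gagliardo Ω s) (F := ℝ) (G := ℝ)
    (fun z => ContinuousLinearMap.lsmul ℝ ℝ (φ z.1 - φ z.2)) Prod.snd
    ⟨measurable_snd, (withDensity_absolutelyContinuous _ _).map measurable_snd |>.trans
      Measure.quasiMeasurePreserving_snd.absolutelyContinuous⟩ ?_
    (∫⁻ z, ENNReal.ofReal (h z)) ?_ ?_
  · intro f hf
    have := hf.measurable
    refine Measurable.aestronglyMeasurable ?_
    simp only [ContinuousLinearMap.lsmul_apply, smul_eq_mul]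
    fun_prop
  · exact hh.lintegral_lt_top.ne
  · intro f hf
    have hfm := hf.measurable
    simp only [ContinuousLinearMap.lsmul_apply, smul_eq_mul]
    rw [gagliardo, lintegral_withDensity_eq_lintegral_mul _ (by fun_prop) (by fun_prop),
      lintegral_prod_symm' _ (by fun_prop), ← lintegral_const_mul' _ _ hh.lintegral_lt_top.ne]
    refine lintegral_mono fun y => ?_
    simp only [Pi.mul_apply]
    -- Here `|φ x - φ y| ≤ min (2C) (L|x - y|)`. Extending the `x`-integral to the whole space makes
    -- it translation invariant, so its value does not depend on `y`.
    calc _ ≤ ∫⁻ x, ENNReal.ofReal (h (x - y)) * ‖f y‖ₑ ^ 2 := by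
          refine (setLIntegral_le_lintegral _ _).trans (lintegral_mono fun x => ?_)
          rw [enorm_mul, mul_pow, ← mul_assoc]
          gcongr
          rw [← ofReal_norm, ← ENNReal.ofReal_pow (norm_nonneg _), mul_comm,
            ← ENNReal.ofReal_mul (by positivity)]
          refine ENNReal.ofReal_le_ofReal ?_
          refine mul_le_mul_of_nonneg (le_min ?_ ?_) ?_ (by positivity) (by positivity)
          · refine pow_le_pow_left₀ (norm_nonneg _) ?_ 2
            refine (norm_sub_le _ _).trans ?_
            linarith [hC x, hC y]
          · rw [← mul_pow]
            refine pow_le_pow_left₀ (norm_nonneg _) ?_ 2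
            rw [← dist_eq_norm, ← dist_eq_norm]
            exact hL.dist_le_mul x y
          · gcongr
            exact le_abs_self _
      _ = _ := by
          rw [lintegral_mul_const _ (by fun_prop),
            lintegral_sub_right_eq_self (fun z => ENNReal.ofReal (h z)) y]

/-- Multiplication by a test function is bounded on `H^s`. -/
theorem exists_mul_Hs {d : ℕ} (hd : 0 < d) {s : ℝ} (hs : s ∈ Ioo (0 : ℝ) 1)
    (Ω : Set (E d)) {Ω' : Set (E d)} {φ : E d → ℝ} (hφ : IsTestFunction Ω' φ) :
    ∃ M : Hs Ω s →L[ℝ] Hs Ω s,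
      ∀ u, (M u).1.fst =ᵐ[(volume : Measure (E d)).restrict Ω] fun x => φ x * u.1.fst x := by
  obtain ⟨C, hC⟩ := hφ.exists_bound
  have hφm : StronglyMeasurable φ := hφ.smooth.continuous.stronglyMeasurable
  obtain ⟨A₁, hA₁⟩ := exists_mul_Lp ((volume : Measure (E d)).restrict Ω)
    (F := ℝ) (G := ℝ)
    (fun x => ContinuousLinearMap.lsmul ℝ ℝ (φ x))
    ((ContinuousLinearMap.lsmul ℝ ℝ).continuous.comp_stronglyMeasurable hφm) C
    (fun x => (ContinuousLinearMap.opNorm_lsmul_apply_le _).trans (hC x))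
  obtain ⟨A₂, hA₂⟩ := exists_mul_Lp (gagliardo Ω s) (F := ℝ) (G := ℝ)
    (fun z => ContinuousLinearMap.lsmul ℝ ℝ (φ z.1))
    ((ContinuousLinearMap.lsmul ℝ ℝ).continuous.comp_stronglyMeasurable
      (hφm.comp_measurable measurable_fst)) C
    (fun x => (ContinuousLinearMap.opNorm_lsmul_apply_le _).trans (hC x.1))
  obtain ⟨A₃, hA₃⟩ := exists_commutator_gagliardo hd hs Ω hφ
  simp only [ContinuousLinearMap.lsmul_apply, smul_eq_mul] at hA₁ hA₂
  let P₁ : WithLp 2 (L2 Ω × Lp ℝ 2 (gagliardo Ω s)) →L[ℝ] L2 Ω :=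
    (ContinuousLinearMap.fst ℝ _ _).comp
      (WithLp.prodContinuousLinearEquiv 2 ℝ _ _).toContinuousLinearMap
  let P₂ : WithLp 2 (L2 Ω × Lp ℝ 2 (gagliardo Ω s)) →L[ℝ] Lp ℝ 2 (gagliardo Ω s) :=
    (ContinuousLinearMap.snd ℝ _ _).comp
      (WithLp.prodContinuousLinearEquiv 2 ℝ _ _).toContinuousLinearMap
  -- The second component encodes `φ(x)u(x) - φ(y)u(y) = φ(x)(u(x) - u(y)) + (φ(x) - φ(y))u(y)`.
  -- Defining the operator on the whole Hilbert sum makes continuity automatic.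
  let N : WithLp 2 (L2 Ω × Lp ℝ 2 (gagliardo Ω s)) →L[ℝ]
      WithLp 2 (L2 Ω × Lp ℝ 2 (gagliardo Ω s)) :=
    (WithLp.prodContinuousLinearEquiv 2 ℝ _ _).symm.toContinuousLinearMap.comp
      ((A₁.comp P₁).prod (A₂.comp P₂ + A₃.comp P₁))
  have hN₁ : ∀ p, (N p).fst = A₁ p.fst := fun p => rfl
  have hN₂ : ∀ p, (N p).snd = A₂ p.snd + A₃ p.fst := fun p => rfl
  have hN : ∀ p ∈ Hs Ω s, N p ∈ Hs Ω s := fun p hp => by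
    have hp' : ∀ᵐ z ∂(gagliardo Ω s), p.snd z = p.fst z.1 - p.fst z.2 := hp
    change ∀ᵐ z ∂(gagliardo Ω s), (N p).snd z = (N p).fst z.1 - (N p).fst z.2
    rw [hN₁, hN₂]
    filter_upwards [hp', Lp.coeFn_add (A₂ p.snd) (A₃ p.fst), hA₂ p.snd, hA₃ p.fst,
      ae_gagliardo_of_ae s (hA₁ p.fst)] with z h1 h2 h3 h4 h5
    rw [h2, Pi.add_apply, h3, h4, h5.1, h5.2, h1]
    ring
  exact ⟨(N.comp (Hs Ω s).subtypeL).codRestrict (Hs Ω s) fun u => hN _ u.2, fun u => hA₁ u.1.fst⟩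

theorem exists_mul_H0s {d : ℕ} (hd : 0 < d) {s : ℝ} (hs : s ∈ Ioo (0 : ℝ) 1)
    {Ω : Set (E d)} {φ : E d → ℝ} (hφ : IsTestFunction Ω φ) (u : H0s Ω s) :
    ∃ v : H0s Ω s, v.1.1.fst =ᵐ[(volume : Measure (E d)).restrict Ω]
      fun x => φ x * u.1.1.fst x := by
  obtain ⟨M, hM⟩ := exists_mul_Hs hd hs Ω hφ
  refine ⟨⟨M u.1, ?_⟩, hM u.1⟩
  refine map_mem_topologicalClosure_span M ?_ u.2
  rintro w ⟨ψ, hψ, hwψ⟩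
  refine ⟨_, hφ.mul hψ, ?_⟩
  filter_upwards [hM w, hwψ] with x h1 h2
  rw [h1, h2]

theorem exists_mul_HTilde {d : ℕ} (hd : 0 < d) {s : ℝ} (hs : s ∈ Ioo (0 : ℝ) 1)
    {Ω : Set (E d)} {φ : E d → ℝ} (hφ : IsTestFunction Ω φ) (u : HTilde Ω s) :
    ∃ v : HTilde Ω s, v.1.1.fst =ᵐ[(volume : Measure (E d)).restrict univ]
      fun x => φ x * u.1.1.fst x := by
  obtain ⟨M, hM⟩ := exists_mul_Hs hd hs univ hφ
  refine ⟨⟨M u.1, ?_⟩, hM u.1⟩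
  have hu : ∀ᵐ x ∂((volume : Measure (E d)).restrict univ), x ∉ Ω → u.1.1.fst x = 0 := u.2
  change ∀ᵐ x ∂((volume : Measure (E d)).restrict univ), x ∉ Ω → (M u.1).1.fst x = 0
  filter_upwards [hM u.1, hu] with x h1 h2 hx
  rw [h1, h2 hx, mul_zero]

/-! ### Gradient estimates for test functions -/

theorem IsTestFunction.add {d : ℕ} {Ω : Set (E d)} {φ ψ : E d → ℝ}
    (hφ : IsTestFunction Ω φ) (hψ : IsTestFunction Ω ψ) : IsTestFunction Ω (φ + ψ) :=
  ⟨hφ.smooth.add hψ.smooth, hφ.compact.add hψ.compact,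
    (tsupport_add φ ψ).trans (union_subset hφ.support_subset hψ.support_subset)⟩

theorem IsTestFunction.const_mul {d : ℕ} {Ω : Set (E d)} {φ : E d → ℝ}
    (hφ : IsTestFunction Ω φ) (c : ℝ) : IsTestFunction Ω fun x => c * φ x :=
  ⟨contDiff_const.mul hφ.smooth, hφ.compact.mul_left,
    tsupport_mul_subset_right.trans hφ.support_subset⟩

/-- Jensen's inequality, used for averages along a segment and over a cube. -/
theorem enorm_integral_sq_le {α : Type*} [MeasurableSpace α] (μ : Measure α)
    [IsProbabilityMeasure μ] {f : α → ℝ} (hf : AEStronglyMeasurable f μ) :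
    ‖∫ x, f x ∂μ‖ₑ ^ 2 ≤ ∫⁻ x, ‖f x‖ₑ ^ 2 ∂μ := by
  rw [← eLpNorm_two_sq]
  refine pow_le_pow_left' ((enorm_integral_le_lintegral_enorm _).trans ?_) 2
  rw [← eLpNorm_one_eq_lintegral_enorm]
  exact eLpNorm_le_eLpNorm_of_exponent_le (by norm_num) hf

theorem norm_gradient {d : ℕ} (φ : E d → ℝ) (x : E d) : ‖gradient φ x‖ = ‖fderiv ℝ φ x‖ := by
  simp [gradient]

theorem enorm_gradient {d : ℕ} (φ : E d → ℝ) (x : E d) : ‖gradient φ x‖ₑ = ‖fderiv ℝ φ x‖ₑ := by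
  rw [← ofReal_norm, ← ofReal_norm, norm_gradient]

theorem IsTestFunction.differentiable {d : ℕ} {Ω : Set (E d)} {φ : E d → ℝ}
    (hφ : IsTestFunction Ω φ) : Differentiable ℝ φ :=
  hφ.smooth.differentiable (by simp)

theorem IsTestFunction.continuous_fderiv {d : ℕ} {Ω : Set (E d)} {φ : E d → ℝ}
    (hφ : IsTestFunction Ω φ) : Continuous (fderiv ℝ φ) :=
  hφ.smooth.continuous_fderiv (by simp)

theorem IsTestFunction.continuous_gradient {d : ℕ} {Ω : Set (E d)} {φ : E d → ℝ}
    (hφ : IsTestFunction Ω φ) : Continuous (gradient φ) :=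
  (InnerProductSpace.toDual ℝ (E d)).symm.continuous.comp hφ.continuous_fderiv

theorem IsTestFunction.exists_gradient_bound {d : ℕ} {Ω : Set (E d)} {φ : E d → ℝ}
    (hφ : IsTestFunction Ω φ) : ∃ C, ∀ x, ‖gradient φ x‖ ≤ C := by
  obtain ⟨C, hC⟩ := (hφ.compact.fderiv (𝕜 := ℝ)).exists_bound_of_continuous hφ.continuous_fderiv
  exact ⟨C, fun x => (norm_gradient φ x).trans_le (hC x)⟩

theorem IsTestFunction.eq_zero {d : ℕ} {Ω : Set (E d)} {φ : E d → ℝ}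
    (hφ : IsTestFunction Ω φ) {x : E d} (hx : x ∉ Ω) : φ x = 0 :=
  image_eq_zero_of_notMem_tsupport fun h => hx (hφ.support_subset h)

theorem IsTestFunction.gradient_eq_zero {d : ℕ} {Ω : Set (E d)} {φ : E d → ℝ}
    (hφ : IsTestFunction Ω φ) {x : E d} (hx : x ∉ Ω) : gradient φ x = 0 := by
  rw [← norm_eq_zero, norm_gradient, norm_eq_zero]
  exact image_eq_zero_of_notMem_tsupport fun h =>
    hx (hφ.support_subset (tsupport_fderiv_subset ℝ h))

/-- The `L²` modulus of continuity is controlled by the gradient. -/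
theorem IsTestFunction.lintegral_translate_sub_le {d : ℕ} {Ω : Set (E d)} {φ : E d → ℝ}
    (hφ : IsTestFunction Ω φ) (z : E d) :
    ∫⁻ x, ‖φ (x + z) - φ x‖ₑ ^ 2 ≤ ‖z‖ₑ ^ 2 * ∫⁻ x, ‖gradient φ x‖ₑ ^ 2 := by
  have hg := hφ.continuous_fderiv
  have hgm : Measurable fun x => ‖gradient φ x‖ₑ ^ 2 :=
    (hφ.continuous_gradient.measurable.enorm).pow_const 2
  have hprob : IsProbabilityMeasure ((volume : Measure ℝ).restrict (Ioc 0 1)) := ⟨by simp⟩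
  -- The fundamental theorem of calculus along the segment from `x` to `x + z`, then Jensen. Tonelli
  -- and translation invariance afterwards remove the shift `τ • z`.
  have hpt : ∀ x, ‖φ (x + z) - φ x‖ₑ ^ 2 ≤
      ∫⁻ τ in Ioc (0 : ℝ) 1, ‖z‖ₑ ^ 2 * ‖gradient φ (x + τ • z)‖ₑ ^ 2 := by
    intro x
    have hcont : Continuous fun τ : ℝ => fderiv ℝ φ (x + τ • z) z := by fun_prop
    have hftc : ∫ τ in (0 : ℝ)..1, fderiv ℝ φ (x + τ • z) z = φ (x + z) - φ x := by
      have hder : ∀ τ : ℝ, HasDerivAt (fun τ : ℝ => φ (x + τ • z))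
          (fderiv ℝ φ (x + τ • z) z) τ := fun τ => by
        have h1 : HasDerivAt (fun τ : ℝ => x + τ • z) z τ := by
          simpa using ((hasDerivAt_id τ).smul_const z).const_add x
        exact (hφ.differentiable _).hasFDerivAt.comp_hasDerivAt τ h1
      rw [intervalIntegral.integral_eq_sub_of_hasDerivAt (fun τ _ => hder τ)
        (hcont.intervalIntegrable _ _)]
      simp
    rw [← hftc, intervalIntegral.integral_of_le zero_le_one]
    refine (enorm_integral_sq_le _ hcont.aestronglyMeasurable).trans (lintegral_mono fun τ => ?_)
    rw [← mul_pow, enorm_gradient, mul_comm]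
    exact pow_le_pow_left' (ContinuousLinearMap.le_opENorm _ _) 2
  refine (lintegral_mono hpt).trans ?_
  rw [lintegral_lintegral_swap]
  · have hinner : ∀ τ : ℝ, ∫⁻ x, ‖z‖ₑ ^ 2 * ‖gradient φ (x + τ • z)‖ₑ ^ 2 =
        ‖z‖ₑ ^ 2 * ∫⁻ x, ‖gradient φ x‖ₑ ^ 2 := fun τ => by
      have hgm' : Measurable fun x => ‖gradient φ (x + τ • z)‖ₑ ^ 2 :=
        hgm.comp (measurable_add_const (τ • z))
      rw [lintegral_const_mul _ hgm',
        lintegral_add_right_eq_self (fun x => ‖gradient φ x‖ₑ ^ 2)]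
    simp only [hinner]
    simp
  · have hc := hφ.continuous_gradient
    have : Continuous fun p : E d × ℝ => gradient φ (p.1 + p.2 • z) := by fun_prop
    exact ((this.measurable.enorm.pow_const 2).const_mul _).aemeasurable

/-! ### The space `H_0^1` -/

/-- The pairs `(φ, ∇φ)` already form a subspace, so the span adds nothing and only limits remain.
Norm inequalities are closed conditions and can thus be proved for test functions alone. -/
theorem H10_induction {d : ℕ} {Ω : Set (E d)} {P : WithLp 2 (L2 Ω × L2Vec Ω) → Prop}
    (hcl : IsClosed {p | P p})
    (h : ∀ p (φ : E d → ℝ), IsTestFunction Ω φ →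
      p.fst =ᵐ[(volume : Measure (E d)).restrict Ω] φ →
      p.snd =ᵐ[(volume : Measure (E d)).restrict Ω] gradient φ → P p) :
    ∀ p ∈ H10 Ω, P p := by
  intro p hp
  refine hcl.closure_subset_iff.2 ?_ hp
  have hspan : ∀ q ∈ Submodule.span ℝ {p : WithLp 2 (L2 Ω × L2Vec Ω) | ∃ φ : E d → ℝ,
      IsTestFunction Ω φ ∧ p.fst =ᵐ[(volume : Measure (E d)).restrict Ω] φ ∧
      p.snd =ᵐ[(volume : Measure (E d)).restrict Ω] gradient φ}, ∃ φ : E d → ℝ,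
      IsTestFunction Ω φ ∧ q.fst =ᵐ[(volume : Measure (E d)).restrict Ω] φ ∧
      q.snd =ᵐ[(volume : Measure (E d)).restrict Ω] gradient φ := by
    intro q hq
    induction hq using Submodule.span_induction with
    | mem q hq => exact hq
    | zero =>
      refine ⟨fun _ => 0, ⟨contDiff_const, HasCompactSupport.zero, ?_⟩,
        Lp.coeFn_zero _ _ _, ?_⟩
      · have : tsupport (fun _ : E d => (0 : ℝ)) = ∅ := tsupport_eq_empty_iff.2 rfl
        rw [this]
        exact empty_subset _
      · filter_upwards [Lp.coeFn_zero (E d) 2 ((volume : Measure (E d)).restrict Ω)] with x hx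
        refine hx.trans ?_
        simp [gradient]
    | add p q _ _ hp hq =>
      obtain ⟨φ, hφ, hp1, hp2⟩ := hp
      obtain ⟨ψ, hψ, hq1, hq2⟩ := hq
      refine ⟨_, hφ.add hψ, ?_, ?_⟩
      · filter_upwards [hp1, hq1, Lp.coeFn_add p.fst q.fst] with x h1 h2 h3
        rw [WithLp.add_fst, h3, Pi.add_apply, Pi.add_apply, h1, h2]
      · filter_upwards [hp2, hq2, Lp.coeFn_add p.snd q.snd] with x h1 h2 h3
        rw [WithLp.add_snd, h3, Pi.add_apply, h1, h2, gradient, gradient, gradient,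
          fderiv_add (hφ.differentiable x) (hψ.differentiable x), map_add]
    | smul c p _ hp =>
      obtain ⟨φ, hφ, hp1, hp2⟩ := hp
      refine ⟨_, hφ.const_mul c, ?_, ?_⟩
      · filter_upwards [hp1, Lp.coeFn_smul c p.fst] with x h1 h3
        rw [WithLp.smul_fst, h3, Pi.smul_apply, h1, smul_eq_mul]
      · filter_upwards [hp2, Lp.coeFn_smul c p.snd] with x h1 h3
        rw [WithLp.smul_snd, h3, Pi.smul_apply, h1, gradient, gradient,
          fderiv_const_mul (hφ.differentiable x), map_smul]
  intro q hq
  obtain ⟨φ, hφ, h1, h2⟩ := hspan q hq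
  exact h q φ hφ h1 h2

/-- Needed for the adjoint of `H10.embed`. -/
instance {d : ℕ} (Ω : Set (E d)) : CompleteSpace (H10 Ω) :=
  (Submodule.isClosed_topologicalClosure _).completeSpace_coe

theorem continuous_withLp_fst {V V' : Type*} [NormedAddCommGroup V] [NormedAddCommGroup V'] :
    Continuous fun p : WithLp 2 (V × V') => p.fst :=
  continuous_fst.comp (WithLp.prod_continuous_ofLp 2 V V')

theorem continuous_withLp_snd {V V' : Type*} [NormedAddCommGroup V] [NormedAddCommGroup V'] :
    Continuous fun p : WithLp 2 (V × V') => p.snd :=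
  continuous_snd.comp (WithLp.prod_continuous_ofLp 2 V V')

/-- Passes to an integral over all of `ℝ^d`, where translations act. -/
theorem ofReal_norm_sq_snd {d : ℕ} {Ω : Set (E d)} {φ : E d → ℝ} (hφ : IsTestFunction Ω φ)
    {U : L2Vec Ω} (hU : U =ᵐ[(volume : Measure (E d)).restrict Ω] gradient φ) :
    ENNReal.ofReal (‖U‖ ^ 2) = ∫⁻ x, ‖gradient φ x‖ₑ ^ 2 := by
  rw [ofReal_norm_sq_Lp, ← setLIntegral_eq_of_support_subset (s := Ω)
    (f := fun x => ‖gradient φ x‖ₑ ^ 2)]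
  · refine lintegral_congr_ae ?_
    filter_upwards [hU] with x hx
    rw [hx]
  · intro x hx
    by_contra hxΩ
    simp [hφ.gradient_eq_zero hxΩ] at hx

/-- The Poincaré inequality. -/
theorem exists_poincare {d : ℕ} (hd : 0 < d) {Ω : Set (E d)} (hΩ : Bornology.IsBounded Ω)
    (hm : MeasurableSet Ω) :
    ∃ C, 0 ≤ C ∧ ∀ p ∈ H10 Ω, ‖p.fst‖ ≤ C * ‖p.snd‖ := by
  obtain ⟨R, hR⟩ := hΩ.subset_closedBall 0
  -- A shift by `2R'` in a coordinate direction moves `Ω` off itself, so `φ (x + 2R'e) = 0` on `Ω`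
  -- and the translation estimate bounds `φ` itself. The `1` makes the separation strict.
  set R' := |R| + 1
  let e : E d := EuclideanSpace.single ⟨0, hd⟩ 1
  have he : ‖e‖ = 1 := by simp [e]
  refine ⟨2 * R', by positivity, H10_induction
    (isClosed_le continuous_withLp_fst.norm (continuous_withLp_snd.norm.const_mul _)) ?_⟩
  intro p φ hφ h1 h2
  refine abs_le_of_sq_le_sq' ?_ (by positivity) |>.2
  refine (ENNReal.ofReal_le_ofReal_iff (by positivity)).1 ?_
  rw [mul_pow, ENNReal.ofReal_mul (by positivity), ofReal_norm_sq_Lp, ofReal_norm_sq_snd hφ h2]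
  have htr := hφ.lintegral_translate_sub_le ((2 * R') • e)
  have hz : ‖(2 * R') • e‖ₑ ^ 2 = ENNReal.ofReal ((2 * R') ^ 2) := by
    rw [← ofReal_norm, norm_smul, he, mul_one, Real.norm_of_nonneg (by positivity),
      ENNReal.ofReal_pow (by positivity)]
  rw [hz] at htr
  refine le_trans ?_ htr
  refine le_trans ?_ (setLIntegral_le_lintegral Ω _)
  refine lintegral_mono_ae ?_
  filter_upwards [h1, ae_restrict_mem hm] with x hx hxΩ
  have hout : x + (2 * R') • e ∉ Ω := by
    intro hmem
    have a1 : ‖x‖ ≤ R := by simpa using hR hxΩ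
    have a2 : ‖x + (2 * R') • e‖ ≤ R := by simpa using hR hmem
    have a3 : ‖(2 * R') • e‖ ≤ ‖x + (2 * R') • e‖ + ‖x‖ := by
      simpa using norm_sub_le (x + (2 * R') • e) x
    rw [norm_smul, he, mul_one, Real.norm_of_nonneg (by positivity)] at a3
    have : R ≤ |R| := le_abs_self R
    simp only [R'] at a3
    linarith
  rw [hx, hφ.eq_zero hout, zero_sub, enorm_neg]

/-- Multiplication by a test function is bounded on `H_0^1`. -/
theorem exists_mul_H10 {d : ℕ} {Ω : Set (E d)} {φ : E d → ℝ} (hφ : IsTestFunction Ω φ) :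
    ∃ (A : L2 Ω →L[ℝ] L2 Ω)
      (M : WithLp 2 (L2 Ω × L2Vec Ω) →L[ℝ] WithLp 2 (L2 Ω × L2Vec Ω)),
      (∀ f, A f =ᵐ[(volume : Measure (E d)).restrict Ω] fun x => φ x * f x) ∧
      (∀ p, (M p).fst = A p.fst) ∧ ∀ p ∈ H10 Ω, M p ∈ H10 Ω := by
  obtain ⟨C, hC⟩ := hφ.exists_bound
  obtain ⟨C', hC'⟩ := hφ.exists_gradient_bound
  have hφm : StronglyMeasurable φ := hφ.smooth.continuous.stronglyMeasurable
  obtain ⟨A₁, hA₁⟩ := exists_mul_Lp ((volume : Measure (E d)).restrict Ω) (F := ℝ) (G := ℝ)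
    (fun x => ContinuousLinearMap.lsmul ℝ ℝ (φ x))
    ((ContinuousLinearMap.lsmul ℝ ℝ).continuous.comp_stronglyMeasurable hφm) C
    (fun x => (ContinuousLinearMap.opNorm_lsmul_apply_le _).trans (hC x))
  obtain ⟨A₂, hA₂⟩ := exists_mul_Lp ((volume : Measure (E d)).restrict Ω) (F := E d) (G := E d)
    (fun x => ContinuousLinearMap.lsmul ℝ ℝ (φ x))
    ((ContinuousLinearMap.lsmul ℝ ℝ).continuous.comp_stronglyMeasurable hφm) C
    (fun x => (ContinuousLinearMap.opNorm_lsmul_apply_le _).trans (hC x))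
  obtain ⟨A₃, hA₃⟩ := exists_mul_Lp ((volume : Measure (E d)).restrict Ω) (F := ℝ) (G := E d)
    (fun x => ContinuousLinearMap.toSpanSingleton ℝ (gradient φ x))
    ((ContinuousLinearMap.toSpanSingletonCLE (𝕜 := ℝ)).continuous.comp_stronglyMeasurable
      hφ.continuous_gradient.stronglyMeasurable) C'
    (fun x => by simpa using hC' x)
  simp only [ContinuousLinearMap.lsmul_apply, smul_eq_mul,
    ContinuousLinearMap.toSpanSingleton_apply] at hA₁ hA₂ hA₃
  let P₁ : WithLp 2 (L2 Ω × L2Vec Ω) →L[ℝ] L2 Ω :=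
    (ContinuousLinearMap.fst ℝ _ _).comp
      (WithLp.prodContinuousLinearEquiv 2 ℝ _ _).toContinuousLinearMap
  let P₂ : WithLp 2 (L2 Ω × L2Vec Ω) →L[ℝ] L2Vec Ω :=
    (ContinuousLinearMap.snd ℝ _ _).comp
      (WithLp.prodContinuousLinearEquiv 2 ℝ _ _).toContinuousLinearMap
  -- The second component is the product rule `∇(φu) = φ∇u + u∇φ`.
  let N : WithLp 2 (L2 Ω × L2Vec Ω) →L[ℝ] WithLp 2 (L2 Ω × L2Vec Ω) :=
    (WithLp.prodContinuousLinearEquiv 2 ℝ _ _).symm.toContinuousLinearMap.comp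
      ((A₁.comp P₁).prod (A₂.comp P₂ + A₃.comp P₁))
  have hN₁ : ∀ p, (N p).fst = A₁ p.fst := fun p => rfl
  have hN₂ : ∀ p, (N p).snd = A₂ p.snd + A₃ p.fst := fun p => rfl
  refine ⟨A₁, N, hA₁, hN₁, fun p hp => map_mem_topologicalClosure_span N ?_ hp⟩
  rintro q ⟨ψ, hψ, h1, h2⟩
  refine ⟨_, hφ.mul hψ, ?_, ?_⟩
  · filter_upwards [hA₁ q.fst, h1] with x a1 a2
    rw [hN₁, a1, a2]
  · filter_upwards [hA₂ q.snd, hA₃ q.fst, h1, h2, Lp.coeFn_add (A₂ q.snd) (A₃ q.fst)]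
      with x a1 a2 a3 a4 a5
    rw [hN₂, a5, Pi.add_apply, a1, a2, a3, a4, gradient, gradient, gradient,
      fderiv_fun_mul (hφ.differentiable x) (hψ.differentiable x), map_add, map_smul, map_smul]

/-! ### Compactness of the embedding of `H_0^1` into `L²` -/

/-- The index of the cube of side `h` containing `x`. -/
def cellIndex {d : ℕ} (h : ℝ) (x : E d) : Fin d → ℤ := fun i => ⌊x i / h⌋

/-- The half-open cubes of side `h` with corners in `h ℤ^d`. -/
def cell {d : ℕ} (h : ℝ) (k : Fin d → ℤ) : Set (E d) := {x | cellIndex h x = k}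

theorem measurableSet_cell {d : ℕ} (h : ℝ) (k : Fin d → ℤ) : MeasurableSet (cell h k) := by
  have hm : Measurable (cellIndex h : E d → Fin d → ℤ) :=
    measurable_pi_lambda _ fun i => Int.measurable_floor.comp (by fun_prop)
  exact hm (measurableSet_singleton k)

theorem volume_cell {d : ℕ} {h : ℝ} (hh : 0 < h) (k : Fin d → ℤ) :
    volume (cell h k) = ENNReal.ofReal (h ^ d) := by
  have heq : cell h k =
      WithLp.ofLp ⁻¹' (univ.pi fun i => Ico ((k i : ℝ) * h) ((k i + 1 : ℝ) * h)) := by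
    ext x
    simp only [cell, cellIndex, mem_ofPred_eq, funext_iff, Int.floor_eq_iff, mem_preimage, Set.mem_pi,
      mem_univ, true_imp_iff, mem_Ico, le_div_iff₀ hh, div_lt_iff₀ hh]
  rw [heq, (PiLp.volume_preserving_ofLp (Fin d)).measure_preimage
    (MeasurableSet.univ_pi fun i => measurableSet_Ico).nullMeasurableSet, Real.volume_pi_Ico]
  simp only [add_mul, one_mul, add_sub_cancel_left, Finset.prod_const, Finset.card_univ,
    Fintype.card_fin]
  rw [ENNReal.ofReal_pow hh.le]

theorem norm_sub_le_of_mem_cell {d : ℕ} {h : ℝ} (hh : 0 < h) {k : Fin d → ℤ} {x y : E d}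
    (hx : x ∈ cell h k) (hy : y ∈ cell h k) : ‖x - y‖ ≤ h * √d := by
  refine abs_le_of_sq_le_sq' ?_ (by positivity) |>.2
  rw [EuclideanSpace.norm_sq_eq, mul_pow, Real.sq_sqrt (by positivity)]
  have hi : ∀ i ∈ Finset.univ, ‖(x - y) i‖ ^ 2 ≤ h ^ 2 := fun i _ => by
    refine pow_le_pow_left₀ (norm_nonneg _) ?_ 2
    have h1 := Int.floor_eq_iff.1 (congrFun hx i)
    have h2 := Int.floor_eq_iff.1 (congrFun hy i)
    rw [le_div_iff₀ hh, div_lt_iff₀ hh] at h1 h2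
    rw [PiLp.sub_apply, Real.norm_eq_abs, abs_le]
    constructor <;> linarith
  refine (Finset.sum_le_sum hi).trans (le_of_eq ?_)
  simp [mul_comm]

theorem finite_image_cellIndex {d : ℕ} {h : ℝ} (hh : 0 < h) {Ω : Set (E d)}
    (hΩ : Bornology.IsBounded Ω) : (cellIndex h '' Ω).Finite := by
  obtain ⟨R, hR⟩ := hΩ.subset_closedBall 0
  refine (finite_Icc (fun _ : Fin d => ⌊-R / h⌋) fun _ => ⌊R / h⌋).subset ?_
  rintro _ ⟨x, hx, rfl⟩
  have hxR : ‖x‖ ≤ R := by simpa using hR hx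
  have hi : ∀ i, |x i| ≤ R := fun i => (PiLp.norm_apply_le x i).trans hxR
  exact ⟨fun i => Int.floor_mono (div_le_div_of_nonneg_right (abs_le.1 (hi i)).1 hh.le),
    fun i => Int.floor_mono (div_le_div_of_nonneg_right (abs_le.1 (hi i)).2 hh.le)⟩

/-- The mean of `φ` over the cube with index `k`. -/
def cellMean {d : ℕ} (h : ℝ) (φ : E d → ℝ) (k : Fin d → ℤ) : ℝ :=
  ∫ y, φ y ∂((ENNReal.ofReal (h ^ d))⁻¹ • (volume : Measure (E d)).restrict (cell h k))

/-- Jensen on the cube containing `x`, which lies in the ball about `x` of radius the diameter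
`h√d`. After recentring, the domain of `z` no longer depends on `x`, so Tonelli applies. -/
theorem enorm_sub_cellMean_sq_le {d : ℕ} {h : ℝ} (hh : 0 < h) {Ω : Set (E d)} {φ : E d → ℝ}
    (hφ : IsTestFunction Ω φ) (x : E d) :
    ‖φ x - cellMean h φ (cellIndex h x)‖ₑ ^ 2 ≤ (ENNReal.ofReal (h ^ d))⁻¹ *
      ∫⁻ z in Metric.closedBall 0 (h * √d), ‖φ (x + z) - φ x‖ₑ ^ 2 := by
  have hv : ENNReal.ofReal (h ^ d) ≠ 0 := by simp [hh]
  set k := cellIndex h x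
  have hx : x ∈ cell h k := rfl
  let μ := (ENNReal.ofReal (h ^ d))⁻¹ • (volume : Measure (E d)).restrict (cell h k)
  have hprob : IsProbabilityMeasure μ := ⟨by
    rw [Measure.smul_apply, Measure.restrict_apply_univ, volume_cell hh, smul_eq_mul,
      ENNReal.inv_mul_cancel hv ENNReal.ofReal_ne_top]⟩
  have hφc := hφ.smooth.continuous
  obtain ⟨C, hC⟩ := hφ.exists_bound
  have hint : Integrable φ μ :=
    Integrable.of_bound hφc.aestronglyMeasurable C (ae_of_all _ hC)
  have hsub : φ x - cellMean h φ k = ∫ y, (φ x - φ y) ∂μ := by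
    rw [integral_sub (integrable_const _) hint, integral_const, probReal_univ, one_smul]
    rfl
  rw [hsub]
  refine (enorm_integral_sq_le μ (by fun_prop)).trans ?_
  rw [lintegral_smul_measure, smul_eq_mul]
  refine mul_le_mul_right ?_ _
  have hshift : ∫⁻ z in Metric.closedBall 0 (h * √d), ‖φ (x + z) - φ x‖ₑ ^ 2 =
      ∫⁻ y in Metric.closedBall x (h * √d), ‖φ y - φ x‖ₑ ^ 2 := by
    rw [← lintegral_indicator Metric.isClosed_closedBall.measurableSet,
      ← lintegral_indicator Metric.isClosed_closedBall.measurableSet,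
      ← lintegral_add_left_eq_self
        ((Metric.closedBall x (h * √d)).indicator fun y => ‖φ y - φ x‖ₑ ^ 2) x]
    refine lintegral_congr fun z => ?_
    by_cases hz : ‖z‖ ≤ h * √d
    · rw [indicator_of_mem (by simpa using hz), indicator_of_mem (by simpa using hz)]
    · rw [indicator_of_notMem (by simpa using hz), indicator_of_notMem (by simpa using hz)]
  rw [hshift]
  have hsubset : cell h k ⊆ Metric.closedBall x (h * √d) := fun y hy => by
    rw [Metric.mem_closedBall, dist_eq_norm]
    exact norm_sub_le_of_mem_cell hh hy hx
  refine (lintegral_mono_set hsubset).trans (le_of_eq (lintegral_congr fun y => ?_))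
  rw [← enorm_neg, neg_sub]

/-- The translation estimate is applied for each `|z| ≤ h√d`. The volume of that ball scales like
`h^d` and cancels the normalization of the mean, leaving a factor of order `h²`. -/
theorem lintegral_sub_cellMean_sq_le {d : ℕ} {h : ℝ} (hh : 0 < h) {Ω : Set (E d)} {φ : E d → ℝ}
    (hφ : IsTestFunction Ω φ) :
    ∫⁻ x, ‖φ x - cellMean h φ (cellIndex h x)‖ₑ ^ 2 ≤
      volume (Metric.closedBall (0 : E d) (√d)) * ENNReal.ofReal (h * √d) ^ 2 *
        ∫⁻ x, ‖gradient φ x‖ₑ ^ 2 := by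
  have hv : ENNReal.ofReal (h ^ d) ≠ 0 := by simp [hh]
  have hφc := hφ.smooth.continuous
  have hmeas : Measurable fun p : E d × E d => ‖φ (p.1 + p.2) - φ p.1‖ₑ ^ 2 :=
    Measurable.pow_const (Continuous.measurable (by fun_prop)) 2
  calc _ ≤ ∫⁻ x, (ENNReal.ofReal (h ^ d))⁻¹ *
        ∫⁻ z in Metric.closedBall 0 (h * √d), ‖φ (x + z) - φ x‖ₑ ^ 2 :=
        lintegral_mono fun x => enorm_sub_cellMean_sq_le hh hφ x
    _ = (ENNReal.ofReal (h ^ d))⁻¹ *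
        ∫⁻ z in Metric.closedBall 0 (h * √d), ∫⁻ x, ‖φ (x + z) - φ x‖ₑ ^ 2 := by
        rw [lintegral_const_mul' _ _ (ENNReal.inv_ne_top.2 hv), lintegral_lintegral_swap]
        exact hmeas.aemeasurable
    _ ≤ (ENNReal.ofReal (h ^ d))⁻¹ * ∫⁻ _ in Metric.closedBall (0 : E d) (h * √d),
        ENNReal.ofReal (h * √d) ^ 2 * ∫⁻ x, ‖gradient φ x‖ₑ ^ 2 := by
        refine mul_le_mul_right ?_ _
        refine setLIntegral_mono' (Metric.isClosed_closedBall (x := (0 : E d))).measurableSet fun z hz => ?_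
        refine (hφ.lintegral_translate_sub_le z).trans ?_
        gcongr
        rw [← ofReal_norm]
        exact ENNReal.ofReal_le_ofReal (by simpa using hz)
    _ = _ := by
        have hfin : Module.finrank ℝ (E d) = d := by simp
        rw [setLIntegral_const, Measure.addHaar_closedBall_mul _ _ hh.le (by positivity), hfin]
        rw [mul_comm (ENNReal.ofReal (h ^ d)) (volume _), mul_comm, mul_assoc, mul_assoc, mul_assoc,
          ENNReal.mul_inv_cancel hv ENNReal.ofReal_ne_top, mul_one]
        ring

/-- Functions in `H_0^1` are approximated, at a rate, by elements of finite-dimensional spaces. -/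
theorem exists_finiteDimensional_approx {d : ℕ} {Ω : Set (E d)} (hΩ : Bornology.IsBounded Ω)
    (hm : MeasurableSet Ω) :
    ∃ C, 0 ≤ C ∧ ∀ h : ℝ, 0 < h → ∃ (K : Submodule ℝ (L2 Ω)) (_ : FiniteDimensional ℝ K),
      ∀ p ∈ H10 Ω, ‖p.fst - K.starProjection p.fst‖ ≤ C * h * ‖p.snd‖ := by
  set V := volume (Metric.closedBall (0 : E d) (√d))
  have hV : V ≠ ⊤ := measure_closedBall_lt_top.ne
  refine ⟨√(V.toReal) * √d, by positivity, fun h hh => ?_⟩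
  let I : Finset (Fin d → ℤ) := (finite_image_cellIndex hh hΩ).toFinset
  have hI : ∀ x ∈ Ω, cellIndex h x ∈ I := fun x hx => by
    simpa [I] using ⟨x, hx, rfl⟩
  have hfin : ∀ k, (volume : Measure (E d)).restrict Ω (cell h k) ≠ ⊤ := fun k =>
    ((Measure.restrict_apply_le _ _).trans_lt
      ((volume_cell hh k).trans_lt ENNReal.ofReal_lt_top)).ne
  let e : (Fin d → ℤ) → L2 Ω := fun k => indicatorConstLp 2 (measurableSet_cell h k) (hfin k) 1
  -- Step functions on the finitely many cubes that meet the bounded set `Ω`.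
  let K : Submodule ℝ (L2 Ω) := Submodule.span ℝ (e '' I)
  have hK : FiniteDimensional ℝ K := FiniteDimensional.span_of_finite ℝ (I.finite_toSet.image e)
  refine ⟨K, hK, H10_induction (isClosed_le
    (continuous_withLp_fst.sub (K.starProjection.continuous.comp continuous_withLp_fst)).norm
    (continuous_withLp_snd.norm.const_mul _)) ?_⟩
  intro p φ hφ h1 h2
  let g : L2 Ω := ∑ k ∈ I, cellMean h φ k • e k
  have hgK : g ∈ K := Submodule.sum_mem _ fun k hk =>
    Submodule.smul_mem _ _ (Submodule.subset_span (mem_image_of_mem e hk))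
  have hg : ∀ᵐ x ∂((volume : Measure (E d)).restrict Ω), g x = cellMean h φ (cellIndex h x) := by
    have he : ∀ k ∈ I, ∀ᵐ x ∂((volume : Measure (E d)).restrict Ω),
        (cellMean h φ k • e k : L2 Ω) x = if cellIndex h x = k then cellMean h φ k else 0 := by
      intro k _
      filter_upwards [Lp.coeFn_smul (cellMean h φ k) (e k),
        indicatorConstLp_coeFn (p := 2) (hs := measurableSet_cell h k) (hμs := hfin k)
          (c := (1 : ℝ))] with x a1 a2
      have a2' : e k x = (cell h k).indicator (fun _ => (1 : ℝ)) x := a2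
      rw [a1, Pi.smul_apply, a2']
      by_cases hx : cellIndex h x = k
      · rw [indicator_of_mem (show x ∈ cell h k from hx), if_pos hx, smul_eq_mul, mul_one]
      · rw [indicator_of_notMem (show x ∉ cell h k from hx), if_neg hx, smul_zero]
    filter_upwards [Lp.coeFn_finsetSum I fun k => cellMean h φ k • e k,
      (Finset.eventually_all I).2 he, ae_restrict_mem hm] with x a1 a2 a3
    rw [a1, Finset.sum_apply, Finset.sum_congr rfl a2, Finset.sum_ite_eq, if_pos (hI x a3)]
  -- The orthogonal projection is the best approximation in `K`, hence at least as good as cube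
  -- means; it is moreover a bounded linear operator on `L²`.
  have hmin : ‖p.fst - K.starProjection p.fst‖ ≤ ‖p.fst - g‖ := by
    rw [Submodule.starProjection_minimal]
    exact ciInf_le (f := fun x : K => ‖p.fst - x‖)
      ⟨0, by rintro _ ⟨x, rfl⟩; exact norm_nonneg _⟩ ⟨g, hgK⟩
  refine hmin.trans (abs_le_of_sq_le_sq' ?_ (by positivity) |>.2)
  refine (ENNReal.ofReal_le_ofReal_iff (by positivity)).1 ?_
  have hconst : ENNReal.ofReal ((√(V.toReal) * √d * h * ‖p.snd‖) ^ 2) =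
      V * ENNReal.ofReal (h * √d) ^ 2 * ENNReal.ofReal (‖p.snd‖ ^ 2) := by
    rw [show (√(V.toReal) * √d * h * ‖p.snd‖) ^ 2 =
      V.toReal * (h * √d) ^ 2 * ‖p.snd‖ ^ 2 by
        rw [mul_pow, mul_pow, mul_pow, Real.sq_sqrt ENNReal.toReal_nonneg]; ring,
      ENNReal.ofReal_mul (by positivity), ENNReal.ofReal_mul (by positivity),
      ENNReal.ofReal_toReal hV, ENNReal.ofReal_pow (by positivity)]
  rw [hconst, ofReal_norm_sq_snd hφ h2, ofReal_norm_sq_Lp]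
  refine le_trans ?_ (lintegral_sub_cellMean_sq_le hh hφ)
  refine le_trans ?_ (setLIntegral_le_lintegral Ω _)
  refine lintegral_mono_ae ?_
  filter_upwards [h1, hg, Lp.coeFn_sub p.fst g] with x a1 a2 a3
  rw [a3, Pi.sub_apply, a1, a2]

/-- The embedding of `H_0^1(Ω)` into `L²(Ω)`. -/
def H10.embed {d : ℕ} (Ω : Set (E d)) : H10 Ω →L[ℝ] L2 Ω :=
  ((ContinuousLinearMap.fst ℝ _ _).comp
    (WithLp.prodContinuousLinearEquiv 2 ℝ (L2 Ω) (L2Vec Ω)).toContinuousLinearMap).comp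
      (H10 Ω).subtypeL

theorem H10.embed_apply {d : ℕ} {Ω : Set (E d)} (p : H10 Ω) : H10.embed Ω p = p.1.fst := rfl

theorem norm_snd_le_norm {V V' : Type*} [NormedAddCommGroup V] [NormedAddCommGroup V']
    (p : WithLp 2 (V × V')) : ‖p.snd‖ ≤ ‖p‖ := by
  refine abs_le_of_sq_le_sq' ?_ (norm_nonneg _) |>.2
  rw [WithLp.prod_norm_sq_eq_of_L2]
  nlinarith [sq_nonneg ‖p.fst‖]

/-- The **Rellich** compactness theorem. -/
theorem H10.isCompactOperator_embed {d : ℕ} {Ω : Set (E d)} (hΩ : Bornology.IsBounded Ω)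
    (hm : MeasurableSet Ω) : IsCompactOperator (H10.embed Ω) := by
  obtain ⟨C, hC0, hC⟩ := exists_finiteDimensional_approx hΩ hm
  choose K hK hKC using fun n : ℕ => hC (1 / ((n : ℝ) + 1)) (by positivity)
  -- With cubes of side `1/(n + 1)`, the embedding is an operator-norm limit of finite-rank
  -- operators.
  refine isCompactOperator_of_tendsto (l := atTop)
    (F := fun n => (K n).starProjection.comp (H10.embed Ω)) ?_ (Eventually.of_forall fun n => ?_)
  · refine (tendsto_iff_norm_sub_tendsto_zero (E := H10 Ω →L[ℝ] L2 Ω)).2 ?_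
    have hlim : Tendsto (fun n : ℕ => C * (1 / ((n : ℝ) + 1))) atTop (𝓝 0) := by
      simpa using tendsto_one_div_add_atTop_nhds_zero_nat.const_mul C
    refine squeeze_zero (fun _ => ContinuousLinearMap.opNorm_nonneg _) (fun n => ?_) hlim
    refine ContinuousLinearMap.opNorm_le_bound _ (by positivity) fun p => ?_
    rw [sub_apply, norm_sub_rev]
    refine (hKC n p.1 p.2).trans ?_
    gcongr
    exact norm_snd_le_norm p.1
  · have hloc : IsCompactOperator (K n).subtypeL := isCompactOperator_of_locallyCompactSpace_rng _
    exact hloc.comp_clm ((K n).orthogonalProjectionOnto.comp (H10.embed Ω))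

/-! ### Completeness of the Dirichlet eigenfunctions -/

theorem IsTestFunction.memLp {d : ℕ} {Ω : Set (E d)} {φ : E d → ℝ} (hφ : IsTestFunction Ω φ) :
    MemLp φ 2 ((volume : Measure (E d)).restrict Ω) :=
  (hφ.smooth.continuous.memLp_of_hasCompactSupport hφ.compact).restrict Ω

theorem IsTestFunction.memLp_gradient {d : ℕ} {Ω : Set (E d)} {φ : E d → ℝ}
    (hφ : IsTestFunction Ω φ) : MemLp (gradient φ) 2 ((volume : Measure (E d)).restrict Ω) := by
  refine (hφ.continuous_gradient.memLp_of_hasCompactSupport ?_).restrict Ω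
  exact (hφ.compact.fderiv (𝕜 := ℝ)).comp_left (map_zero (InnerProductSpace.toDual ℝ (E d)).symm)

/-- The pair `(φ, ∇φ)` as an element of `H_0^1`. -/
theorem IsTestFunction.exists_mem_H10 {d : ℕ} {Ω : Set (E d)} {φ : E d → ℝ}
    (hφ : IsTestFunction Ω φ) : ∃ p ∈ H10 Ω, p.fst =ᵐ[(volume : Measure (E d)).restrict Ω] φ :=
  ⟨WithLp.toLp 2 (hφ.memLp.toLp φ, hφ.memLp_gradient.toLp (gradient φ)),
    Submodule.le_topologicalClosure _ (Submodule.subset_span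
      ⟨φ, hφ, hφ.memLp.coeFn_toLp, hφ.memLp_gradient.coeFn_toLp⟩), hφ.memLp.coeFn_toLp⟩

/-- `H_0^1` is dense in `L²`. -/
theorem eq_zero_of_forall_inner_H10 {d : ℕ} {Ω : Set (E d)} (hΩ : IsOpen Ω) {u : L2 Ω}
    (hu : ∀ p ∈ H10 Ω, ⟪u, p.fst⟫ = 0) : u = 0 := by
  have hloc : LocallyIntegrableOn (u : E d → ℝ) Ω :=
    locallyIntegrableOn_of_locallyIntegrable_restrict
      ((Lp.memLp u).locallyIntegrable (by norm_num))
  have h := hΩ.ae_eq_zero_of_integral_contDiff_smul_eq_zero hloc fun g hg hgc hgs => by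
    have hφ : IsTestFunction Ω g := ⟨hg, hgc, hgs⟩
    obtain ⟨p, hp, hpg⟩ := hφ.exists_mem_H10
    have h0 := hu p hp
    rw [L2.inner_def] at h0
    rw [← h0, ← setIntegral_eq_integral_of_forall_compl_eq_zero (s := Ω)
      (fun x hx => by rw [hφ.eq_zero hx, zero_smul])]
    refine integral_congr_ae ?_
    filter_upwards [hpg] with x hx
    rw [hx]
    simp
  refine Lp.ext ?_
  filter_upwards [(ae_restrict_iff' hΩ.measurableSet).2 h, Lp.coeFn_zero ℝ 2
    ((volume : Measure (E d)).restrict Ω)] with x h1 h2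
  rw [h1, h2, Pi.zero_apply]

/-- The resolvent `(1 - Δ)⁻¹` of the Dirichlet Laplacian on `L²(Ω)`. -/
def dirichletResolvent {d : ℕ} (Ω : Set (E d)) : L2 Ω →L[ℝ] L2 Ω :=
  (H10.embed Ω).comp (ContinuousLinearMap.adjoint (H10.embed Ω))

theorem inner_H10 {d : ℕ} {Ω : Set (E d)} (p q : H10 Ω) :
    ⟪p, q⟫ = ⟪p.1.fst, q.1.fst⟫ + ⟪p.1.snd, q.1.snd⟫ := by
  rw [Submodule.coe_inner, WithLp.prod_inner_apply]
  rfl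

/-- The weak form of `a - Δa = u` for `a` the adjoint embedding of `u`, since `H10` carries the full
norm. -/
theorem inner_adjoint_embed {d : ℕ} {Ω : Set (E d)} (u : L2 Ω) (q : H10 Ω) :
    ⟪ContinuousLinearMap.adjoint (H10.embed Ω) u, q⟫ = ⟪u, q.1.fst⟫ := by
  rw [ContinuousLinearMap.adjoint_inner_left, H10.embed_apply]

theorem inner_smul_adjoint_embed {d : ℕ} {Ω : Set (E d)} (c : ℝ) (u : L2 Ω) (q : H10 Ω) :
    ⟪c • ContinuousLinearMap.adjoint (H10.embed Ω) u, q⟫ = c * ⟪u, q.1.fst⟫ :=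
  (real_inner_smul_left _ _ _).trans (congrArg (c * ·) (inner_adjoint_embed u q))

theorem isSymmetric_dirichletResolvent {d : ℕ} (Ω : Set (E d)) :
    (dirichletResolvent Ω).IsSymmetric := fun u v => by
  change ⟪H10.embed Ω (ContinuousLinearMap.adjoint (H10.embed Ω) u), v⟫ =
    ⟪u, H10.embed Ω (ContinuousLinearMap.adjoint (H10.embed Ω) v)⟫
  rw [← ContinuousLinearMap.adjoint_inner_right, ContinuousLinearMap.adjoint_inner_left]

/-- With `J` the embedding, `‖J*u‖² = ⟪u, JJ*u⟫ = 0`, so `u` is orthogonal to the dense range of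
`J`. -/
theorem eq_zero_of_dirichletResolvent_eq_zero {d : ℕ} {Ω : Set (E d)} (hΩ : IsOpen Ω) {u : L2 Ω}
    (hu : dirichletResolvent Ω u = 0) : u = 0 := by
  have h0 : ContinuousLinearMap.adjoint (H10.embed Ω) u = 0 := by
    rw [← inner_self_eq_zero (𝕜 := ℝ), ContinuousLinearMap.adjoint_inner_left]
    change ⟪u, dirichletResolvent Ω u⟫ = 0
    rw [hu, inner_zero_right]
  refine eq_zero_of_forall_inner_H10 hΩ fun p hp => ?_
  rw [← inner_adjoint_embed u ⟨p, hp⟩, h0, inner_zero_left]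

theorem dirichletResolvent_eigenfunction {d : ℕ} {Ω : Set (E d)} {μ : ℝ} {u : L2 Ω}
    (hu : IsDirichletEigenfunction Ω μ u) : (1 + μ) • dirichletResolvent Ω u = u := by
  obtain ⟨_, _, p, hp, rfl, hpq⟩ := hu
  have h : (1 + μ) • ContinuousLinearMap.adjoint (H10.embed Ω) p.fst = ⟨p, hp⟩ := by
    refine ext_inner_right ℝ fun q => ?_
    rw [inner_smul_adjoint_embed, inner_H10, hpq q.1 q.2]
    ring
  have h' := congrArg (H10.embed Ω) h
  rw [map_smul] at h'
  exact h'

/-- `(1 - Δ)u = κ⁻¹u` means `-Δu = (κ⁻¹ - 1)u`. Positivity of the eigenvalue comes from `‖∇u‖² =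
(κ⁻¹ - 1)‖u‖²`, where Poincaré excludes `∇u = 0`. -/
theorem isDirichletEigenfunction_of_resolvent {d : ℕ} (hd : 0 < d) {Ω : Set (E d)}
    (hΩ : IsOpen Ω) (hb : Bornology.IsBounded Ω) {κ : ℝ} (hκ : κ ≠ 0) {u : L2 Ω} (hu0 : u ≠ 0)
    (hu : dirichletResolvent Ω u = κ • u) : IsDirichletEigenfunction Ω (κ⁻¹ - 1) u := by
  let p : H10 Ω := κ⁻¹ • ContinuousLinearMap.adjoint (H10.embed Ω) u
  have hpu : p.1.fst = u := by
    change κ⁻¹ • dirichletResolvent Ω u = u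
    rw [hu, inv_smul_smul₀ hκ]
  have hpq : ∀ q ∈ H10 Ω, ⟪p.1.snd, q.snd⟫ = (κ⁻¹ - 1) * ⟪p.1.fst, q.fst⟫ := fun q hq => by
    have h1 := inner_H10 p ⟨q, hq⟩
    have h2 : ⟪p, (⟨q, hq⟩ : H10 Ω)⟫ = κ⁻¹ * ⟪u, q.fst⟫ :=
      inner_smul_adjoint_embed κ⁻¹ u ⟨q, hq⟩
    rw [h2, hpu] at h1
    rw [hpu]
    linarith
  refine ⟨hu0, ?_, p.1, p.2, hpu, hpq⟩
  obtain ⟨C, hC0, hC⟩ := exists_poincare hd hb hΩ.measurableSet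
  have h3 := hC p.1 p.2
  have h4 := hpq p.1 p.2
  rw [hpu] at h3 h4
  rw [real_inner_self_eq_norm_sq, real_inner_self_eq_norm_sq] at h4
  have hun : 0 < ‖u‖ := norm_pos_iff.2 hu0
  have hps : 0 < ‖p.1.snd‖ := by
    by_contra! hneg
    have : ‖p.1.snd‖ = 0 := le_antisymm hneg (norm_nonneg _)
    rw [this, mul_zero] at h3
    linarith
  have : 0 < (κ⁻¹ - 1) * ‖u‖ ^ 2 := h4 ▸ pow_pos hps 2
  exact pos_of_mul_pos_left this (by positivity)

/-- The Dirichlet eigenfunctions are complete in `L²(Ω)`. -/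
theorem DirichletEigensystem.orthogonal_eq_bot {d : ℕ} (hd : 0 < d) {Ω : Set (E d)}
    (hΩ : IsOpen Ω) (hb : Bornology.IsBounded Ω) {ι : Type} (S : DirichletEigensystem Ω ι) :
    (Submodule.span ℝ (range S.fn))ᗮ = ⊥ := by
  set V := (Submodule.span ℝ (range S.fn))ᗮ with hV
  have hmemV : ∀ u, u ∈ V ↔ ∀ n, ⟪S.fn n, u⟫ = 0 := fun u => by
    rw [hV, Submodule.mem_orthogonal]
    refine ⟨fun h n => h _ (Submodule.subset_span ⟨n, rfl⟩), fun h v hv => ?_⟩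
    induction hv using Submodule.span_induction with
    | mem v hv => obtain ⟨n, rfl⟩ := hv; exact h n
    | zero => exact inner_zero_left _
    | add v w _ _ hv hw => rw [inner_add_left, hv, hw, add_zero]
    | smul c v _ hv => rw [inner_smul_left, hv, mul_zero]
  -- The resolvent is symmetric and each `S.fn n` is one of its eigenvectors.
  have hinv : ∀ u ∈ V, dirichletResolvent Ω u ∈ V := fun u hu => by
    rw [hmemV] at hu ⊢
    intro n
    have hsymm : ⟪dirichletResolvent Ω (S.fn n), u⟫ = ⟪S.fn n, dirichletResolvent Ω u⟫ :=
      isSymmetric_dirichletResolvent Ω _ _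
    have hn : (1 + S.ev n) * ⟪dirichletResolvent Ω (S.fn n), u⟫ = 0 := by
      rw [← hu n, ← real_inner_smul_left, dirichletResolvent_eigenfunction (S.eigen n)]
    rw [← hsymm]
    exact (mul_eq_zero.1 hn).resolve_left (by linarith [(S.eigen n).2.1])
  have hcomp : IsCompactOperator (dirichletResolvent Ω) :=
    (H10.isCompactOperator_embed hb hΩ.measurableSet).comp_clm _
  let T : V →L[ℝ] V := (dirichletResolvent Ω).restrict hinv
  have hTc : IsCompactOperator T := hcomp.restrict' hinv
  have hTs : T.IsSymmetric := (isSymmetric_dirichletResolvent Ω).restrict_invariant hinv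
  have hbot := ContinuousLinearMap.orthogonalComplement_iSup_eigenspaces_eq_bot hTc hTs
  -- An eigenvector in `V` would be a Dirichlet eigenfunction orthogonal to the whole system,
  -- against maximality. A compact symmetric operator without eigenvectors lives on the zero space.
  have heig : ∀ κ, Module.End.eigenspace (T : Module.End ℝ V) κ = ⊥ := fun κ => by
    rw [Submodule.eq_bot_iff]
    intro v hv
    by_contra hv0
    have hv' : dirichletResolvent Ω v.1 = κ • v.1 :=
      congrArg Subtype.val (Module.End.mem_eigenspace_iff.1 hv)
    have hv0' : v.1 ≠ 0 := fun h => hv0 (Subtype.ext h)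
    have hκ : κ ≠ 0 := by
      rintro rfl
      rw [zero_smul] at hv'
      exact hv0' (eq_zero_of_dirichletResolvent_eq_zero hΩ hv')
    obtain ⟨n, hn⟩ := S.maximal _ _ (isDirichletEigenfunction_of_resolvent hd hΩ hb hκ hv0' hv')
    exact hn ((hmemV v.1).1 v.2 n)
  simp only [heig, iSup_bot, Submodule.bot_orthogonal_eq_top] at hbot
  rw [Submodule.eq_bot_iff]
  intro u hu
  have : (⟨u, hu⟩ : V) ∈ (⊤ : Submodule ℝ V) := trivial
  rw [hbot, Submodule.mem_bot] at this
  exact congrArg Subtype.val this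

/-- Makes the expansion condition of `specSubmodule` automatic; only summability remains to be
checked for products. -/
theorem DirichletEigensystem.hasSum {d : ℕ} (hd : 0 < d) {Ω : Set (E d)}
    (hΩ : IsOpen Ω) (hb : Bornology.IsBounded Ω) {ι : Type} (S : DirichletEigensystem Ω ι)
    (u : L2 Ω) : HasSum (fun n => ⟪S.fn n, u⟫ • S.fn n) u := by
  let b := HilbertBasis.mkOfOrthogonalEqBot S.orthonormal (S.orthogonal_eq_bot hd hΩ hb)
  have hbn : ∀ n, b n = S.fn n := fun n => by simp [b]
  simpa only [HilbertBasis.repr_apply_apply, hbn] using b.hasSum_repr u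

/-! ### Multiplication by test functions in the spectral space -/

/-- For `0 < s < 1`, `λ^s` is a constant multiple of `∫₀^∞ t^(s-1) λ/(t + λ) dt`, with a positive
constant depending only on `s`. The hypothesis is weighted by `t^(s-1)` and integrated. -/
theorem sum_rpow_mul_sq_le_of_resolvent {ι : Type*} {s : ℝ} (hs : s ∈ Ioo (0 : ℝ) 1)
    {ev : ι → ℝ} (hev : ∀ n, 0 < ev n) (G N : Finset ι) (x y : ι → ℝ) (D : ℝ)
    (h : ∀ t, 0 < t → ∑ n ∈ G, ev n / (t + ev n) * x n ^ 2 ≤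
      D * ∑ n ∈ N, ev n / (t + ev n) * y n ^ 2) :
    ∑ n ∈ G, ev n ^ s * x n ^ 2 ≤ D * ∑ n ∈ N, ev n ^ s * y n ^ 2 := by
  have hint : ∀ n, IntegrableOn (fun t => Real.rpowIntegrand₀₁ s t (ev n)) (Ioi 0) := fun n =>
    Real.integrableOn_rpowIntegrand₀₁_Ioi hs (hev n).le
  have hsum : ∀ (H : Finset ι) (z : ι → ℝ),
      ∫ t in Ioi 0, ∑ n ∈ H, Real.rpowIntegrand₀₁ s t (ev n) * z n ^ 2 =
        (∑ n ∈ H, ev n ^ s * z n ^ 2) * ∫ t in Ioi 0, Real.rpowIntegrand₀₁ s t 1 := by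
    intro H z
    rw [integral_finsetSum _ fun n _ => (hint n).mul_const _, Finset.sum_mul]
    refine Finset.sum_congr rfl fun n _ => ?_
    rw [integral_mul_const, Real.integral_rpowIntegrand₀₁_eq_rpow_mul_const hs (hev n).le]
    ring
  have hsumint : ∀ (H : Finset ι) (z : ι → ℝ),
      IntegrableOn (fun t => ∑ n ∈ H, Real.rpowIntegrand₀₁ s t (ev n) * z n ^ 2) (Ioi 0) :=
    fun H z => integrable_finsetSum _ fun n _ => (hint n).mul_const _
  have hle : ∫ t in Ioi 0, ∑ n ∈ G, Real.rpowIntegrand₀₁ s t (ev n) * x n ^ 2 ≤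
      ∫ t in Ioi 0, D * ∑ n ∈ N, Real.rpowIntegrand₀₁ s t (ev n) * y n ^ 2 := by
    refine setIntegral_mono_on (hsumint G x) ((hsumint N y).const_mul D) measurableSet_Ioi
      fun t ht => ?_
    have ht0 : 0 < t := ht
    have hfac : ∀ (H : Finset ι) (z : ι → ℝ),
        ∑ n ∈ H, Real.rpowIntegrand₀₁ s t (ev n) * z n ^ 2 =
          t ^ (s - 1) * ∑ n ∈ H, ev n / (t + ev n) * z n ^ 2 := fun H z => by
      rw [Finset.mul_sum]
      refine Finset.sum_congr rfl fun n _ => ?_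
      rw [Real.rpowIntegrand₀₁_eq_pow_div hs ht0.le (hev n).le]
      ring
    rw [hfac, hfac, mul_left_comm]
    exact mul_le_mul_of_nonneg_left (h t ht0) (by positivity)
  rw [integral_const_mul, hsum, hsum, ← mul_assoc] at hle
  exact le_of_mul_le_mul_right hle (Real.integral_rpowIntegrand₀₁_one_pos hs)

namespace DirichletEigensystem

variable {d : ℕ} {Ω : Set (E d)} {ι : Type} (S : DirichletEigensystem Ω ι)

/-- The eigenfunctions together with their gradients. -/
def pair (n : ι) : WithLp 2 (L2 Ω × L2Vec Ω) := (S.eigen n).2.2.choose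

theorem pair_mem (n : ι) : S.pair n ∈ H10 Ω := (S.eigen n).2.2.choose_spec.1

theorem pair_fst (n : ι) : (S.pair n).fst = S.fn n := (S.eigen n).2.2.choose_spec.2.1

theorem inner_pair_snd (n : ι) {q : WithLp 2 (L2 Ω × L2Vec Ω)} (hq : q ∈ H10 Ω) :
    ⟪(S.pair n).snd, q.snd⟫ = S.ev n * ⟪S.fn n, q.fst⟫ := by
  rw [← S.pair_fst n]
  exact (S.eigen n).2.2.choose_spec.2.2 q hq

theorem sum_pair_mem (N : Finset ι) (a : ι → ℝ) : ∑ n ∈ N, a n • S.pair n ∈ H10 Ω :=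
  Submodule.sum_mem _ fun n _ => Submodule.smul_mem _ _ (S.pair_mem n)

theorem sum_pair_fst (N : Finset ι) (a : ι → ℝ) :
    (∑ n ∈ N, a n • S.pair n).fst = ∑ n ∈ N, a n • S.fn n := by
  change WithLp.fstₗ 2 ℝ _ _ _ = _
  rw [map_sum]
  refine Finset.sum_congr rfl fun n _ => ?_
  rw [map_smul, ← S.pair_fst n]
  rfl

theorem sum_pair_snd (N : Finset ι) (a : ι → ℝ) :
    (∑ n ∈ N, a n • S.pair n).snd = ∑ n ∈ N, a n • (S.pair n).snd := by
  change WithLp.sndₗ 2 ℝ _ _ _ = _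
  rw [map_sum]
  refine Finset.sum_congr rfl fun n _ => ?_
  rw [map_smul]
  rfl

theorem inner_sum_pair_snd (N : Finset ι) (a : ι → ℝ) {q : WithLp 2 (L2 Ω × L2Vec Ω)}
    (hq : q ∈ H10 Ω) :
    ⟪(∑ n ∈ N, a n • S.pair n).snd, q.snd⟫ = ∑ n ∈ N, S.ev n * (a n * ⟪S.fn n, q.fst⟫) := by
  rw [S.sum_pair_snd, sum_inner]
  refine Finset.sum_congr rfl fun n _ => ?_
  rw [real_inner_smul_left, S.inner_pair_snd n hq]
  ring

theorem norm_sum_pair_snd_sq (N : Finset ι) (a : ι → ℝ) :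
    ‖(∑ n ∈ N, a n • S.pair n).snd‖ ^ 2 = ∑ n ∈ N, S.ev n * a n ^ 2 := by
  rw [← real_inner_self_eq_norm_sq, S.inner_sum_pair_snd N a (S.sum_pair_mem N a)]
  refine Finset.sum_congr rfl fun n hn => ?_
  rw [S.sum_pair_fst, S.orthonormal.inner_right_sum a hn]
  ring

theorem norm_sum_fn_sq (N : Finset ι) (a : ι → ℝ) :
    ‖∑ n ∈ N, a n • S.fn n‖ ^ 2 = ∑ n ∈ N, a n ^ 2 := by
  rw [← real_inner_self_eq_norm_sq, sum_inner]
  refine Finset.sum_congr rfl fun n hn => ?_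
  rw [real_inner_smul_left, S.orthonormal.inner_right_sum a hn]
  ring

/-- Bessel's inequality in `H_0^1`. -/
theorem sum_ev_mul_sq_le {p : WithLp 2 (L2 Ω × L2Vec Ω)} (hp : p ∈ H10 Ω) (G : Finset ι) :
    ∑ n ∈ G, S.ev n * ⟪S.fn n, p.fst⟫ ^ 2 ≤ ‖p.snd‖ ^ 2 := by
  set q := ∑ n ∈ G, ⟪S.fn n, p.fst⟫ • S.pair n
  have h1 : ⟪q.snd, p.snd⟫ = ∑ n ∈ G, S.ev n * ⟪S.fn n, p.fst⟫ ^ 2 := by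
    rw [S.inner_sum_pair_snd G _ hp]
    exact Finset.sum_congr rfl fun n _ => by ring
  have h2 : ‖q.snd‖ ^ 2 = ∑ n ∈ G, S.ev n * ⟪S.fn n, p.fst⟫ ^ 2 := S.norm_sum_pair_snd_sq G _
  have h3 := norm_sub_sq_real q.snd p.snd
  rw [h1, h2] at h3
  nlinarith [sq_nonneg ‖q.snd - p.snd‖]

/-- The quadratic form `∑ λ t / (t + λ) uₙ²` is bounded by the energy of any splitting of `u`. -/
theorem sum_parallel_le {p : WithLp 2 (L2 Ω × L2Vec Ω)} (hp : p ∈ H10 Ω) (b : L2 Ω)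
    (G : Finset ι) {t : ℝ} (ht : 0 < t) :
    t * ∑ n ∈ G, S.ev n / (t + S.ev n) * ⟪S.fn n, p.fst + b⟫ ^ 2 ≤
      ‖p.snd‖ ^ 2 + t * ‖b‖ ^ 2 := by
  have hb : ∑ n ∈ G, ⟪S.fn n, b⟫ ^ 2 ≤ ‖b‖ ^ 2 := by
    simpa using S.orthonormal.sum_inner_products_le (s := G) b
  refine le_trans ?_ (add_le_add (S.sum_ev_mul_sq_le hp G) (mul_le_mul_of_nonneg_left hb ht.le))
  rw [Finset.mul_sum, Finset.mul_sum, ← Finset.sum_add_distrib]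
  refine Finset.sum_le_sum fun n _ => ?_
  have hev := (S.eigen n).2.1
  rw [inner_add_right]
  set x := ⟪S.fn n, p.fst⟫
  set y := ⟪S.fn n, b⟫
  rw [← mul_assoc, mul_div_assoc', div_mul_eq_mul_div, div_le_iff₀ (by positivity)]
  -- After clearing denominators the two sides differ by exactly `(λx - ty)²`.
  nlinarith [sq_nonneg (S.ev n * x - t * y)]

/-- An operator bounded both on `L²` and on `H_0^1` is bounded on the interpolation spaces. -/
theorem exists_interpolation_bound {C : ℝ} (hC : ∀ p ∈ H10 Ω, ‖p.fst‖ ≤ C * ‖p.snd‖)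
    {s : ℝ} (hs : s ∈ Ioo (0 : ℝ) 1) (A : L2 Ω →L[ℝ] L2 Ω)
    (M : WithLp 2 (L2 Ω × L2Vec Ω) →L[ℝ] WithLp 2 (L2 Ω × L2Vec Ω))
    (hMA : ∀ p, (M p).fst = A p.fst) (hM : ∀ p ∈ H10 Ω, M p ∈ H10 Ω) :
    ∃ D, 0 ≤ D ∧ ∀ (G N : Finset ι) (c : ι → ℝ),
      ∑ n ∈ G, S.ev n ^ s * ⟪S.fn n, A (∑ n ∈ N, c n • S.fn n)⟫ ^ 2 ≤
        D * ∑ n ∈ N, S.ev n ^ s * c n ^ 2 := by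
  -- By Poincaré, `C² + 1` bounds the full `H_0^1` norm squared by the gradient part, so `M` is
  -- bounded for the gradient seminorm.
  set D₁ := ‖M‖ ^ 2 * (C ^ 2 + 1)
  set D := max D₁ (‖A‖ ^ 2)
  have hD : 0 ≤ D := le_max_of_le_right (by positivity)
  refine ⟨D, hD, fun G N c =>
    sum_rpow_mul_sq_le_of_resolvent hs (fun n => (S.eigen n).2.1) G N _ _ D fun t ht => ?_⟩
  have hpos : ∀ n, 0 < t + S.ev n := fun n => add_pos ht (S.eigen n).2.1
  -- The optimal splitting, for which `λx = ty` in every mode: its energy equals the quadratic form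
  -- exactly (`h4`).
  set p := ∑ n ∈ N, (t / (t + S.ev n) * c n) • S.pair n
  set b := ∑ n ∈ N, (S.ev n / (t + S.ev n) * c n) • S.fn n
  have hp : p ∈ H10 Ω := S.sum_pair_mem N _
  have hsplit : A (∑ n ∈ N, c n • S.fn n) = (M p).fst + A b := by
    rw [hMA, ← map_add, S.sum_pair_fst, ← Finset.sum_add_distrib]
    congr 1
    refine Finset.sum_congr rfl fun n _ => ?_
    rw [← add_smul, ← add_mul, ← add_div, div_self (hpos n).ne', one_mul]
  have h1 : ‖(M p).snd‖ ^ 2 ≤ D * ‖p.snd‖ ^ 2 := by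
    have hfst : ‖p.fst‖ ^ 2 ≤ C ^ 2 * ‖p.snd‖ ^ 2 := by
      rw [← mul_pow]
      exact pow_le_pow_left₀ (norm_nonneg _) (hC p hp) 2
    have hnorm : ‖p‖ ^ 2 ≤ (C ^ 2 + 1) * ‖p.snd‖ ^ 2 := by
      rw [WithLp.prod_norm_sq_eq_of_L2]
      linarith
    calc ‖(M p).snd‖ ^ 2 ≤ (‖M‖ * ‖p‖) ^ 2 :=
          pow_le_pow_left₀ (norm_nonneg _) ((norm_snd_le_norm _).trans (M.le_opNorm p)) 2
      _ = ‖M‖ ^ 2 * ‖p‖ ^ 2 := mul_pow _ _ _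
      _ ≤ ‖M‖ ^ 2 * ((C ^ 2 + 1) * ‖p.snd‖ ^ 2) := by gcongr
      _ = D₁ * ‖p.snd‖ ^ 2 := by ring
      _ ≤ D * ‖p.snd‖ ^ 2 := by gcongr; exact le_max_left _ _
  have h2 : ‖A b‖ ^ 2 ≤ D * ‖b‖ ^ 2 := by
    calc ‖A b‖ ^ 2 ≤ (‖A‖ * ‖b‖) ^ 2 := pow_le_pow_left₀ (norm_nonneg _) (A.le_opNorm b) 2
      _ = ‖A‖ ^ 2 * ‖b‖ ^ 2 := mul_pow _ _ _
      _ ≤ D * ‖b‖ ^ 2 := by gcongr; exact le_max_right _ _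
  have h3 := S.sum_parallel_le (hM p hp) (A b) G ht
  rw [← hsplit] at h3
  have h4 : ‖p.snd‖ ^ 2 + t * ‖b‖ ^ 2 = t * ∑ n ∈ N, S.ev n / (t + S.ev n) * c n ^ 2 := by
    rw [S.norm_sum_pair_snd_sq, S.norm_sum_fn_sq, Finset.mul_sum, Finset.mul_sum,
      ← Finset.sum_add_distrib]
    refine Finset.sum_congr rfl fun n _ => ?_
    have := (hpos n).ne'
    field_simp
  refine le_of_mul_le_mul_left ?_ ht
  calc _ ≤ _ := h3
    _ ≤ D * ‖p.snd‖ ^ 2 + t * (D * ‖b‖ ^ 2) := by gcongr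
    _ = D * (‖p.snd‖ ^ 2 + t * ‖b‖ ^ 2) := by ring
    _ = _ := by rw [h4]; ring

end DirichletEigensystem

/-- The interpolation bound holds for finite partial sums of `w`. For fixed `G` it passes to the
limit by continuity of multiplication on `L²`, and uniformity in `G` gives summability. -/
theorem exists_mul_specSubmodule {d : ℕ} (hd : 0 < d) {Ω : Set (E d)} (hΩ : IsOpen Ω)
    (hb : Bornology.IsBounded Ω) {s : ℝ} (hs : s ∈ Ioo (0 : ℝ) 1) {ι : Type}
    (S : DirichletEigensystem Ω ι) {φ : E d → ℝ} (hφ : IsTestFunction Ω φ) {w : L2 Ω}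
    (hw : w ∈ specSubmodule S s) :
    ∃ v ∈ specSubmodule S s, v =ᵐ[(volume : Measure (E d)).restrict Ω] fun x => φ x * w x := by
  obtain ⟨A, M, hA, hMA, hM⟩ := exists_mul_H10 hφ
  obtain ⟨C, -, hC⟩ := exists_poincare hd hb hΩ.measurableSet
  obtain ⟨D, hD, hbound⟩ := S.exists_interpolation_bound hC hs A M hMA hM
  obtain ⟨hw1, hw2⟩ := hw
  have hnn : ∀ n (x : ℝ), 0 ≤ S.ev n ^ s * x ^ 2 := fun n x =>
    mul_nonneg (Real.rpow_nonneg (S.eigen n).2.1.le s) (sq_nonneg x)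
  refine ⟨A w, ⟨S.hasSum hd hΩ hb _, ?_⟩, hA w⟩
  refine summable_of_sum_le (c := D * ∑' n, S.ev n ^ s * ⟪S.fn n, w⟫ ^ 2) (fun n => hnn n _)
    fun G => ?_
  have hlim : Tendsto (fun N : Finset ι =>
      ∑ n ∈ G, S.ev n ^ s * ⟪S.fn n, A (∑ n ∈ N, ⟪S.fn n, w⟫ • S.fn n)⟫ ^ 2) atTop
      (𝓝 (∑ n ∈ G, S.ev n ^ s * ⟪S.fn n, A w⟫ ^ 2)) := by
    refine tendsto_finsetSum _ fun n _ => ?_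
    have hAw : Tendsto (fun N : Finset ι => A (∑ n ∈ N, ⟪S.fn n, w⟫ • S.fn n)) atTop (𝓝 (A w)) :=
      (A.continuous.tendsto w).comp hw1
    exact ((tendsto_const_nhds.inner hAw).pow 2).const_mul _
  refine le_of_tendsto' hlim fun N => (hbound G N _).trans ?_
  exact mul_le_mul_of_nonneg_left (hw2.sum_le_tsum N fun n _ => hnn n _) hD

/-! ### First-order conditions -/

namespace W

variable {d : ℕ} {Ω : Set (E d)} {s : ℝ}

theorem toFun_add_smul {k : InnerChoice Ω} (w v : W s k) (t : ℝ) :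
    ∀ᵐ x ∂((volume : Measure (E d)).restrict Ω),
      (w + t • v).toFun x = w.toFun x + t * v.toFun x := by
  have hL2 : ∀ {Ω' : Set (E d)} (f g : L2 Ω'), ∀ᵐ x ∂((volume : Measure (E d)).restrict Ω'),
      (f + t • g : L2 Ω') x = f x + t * g x := fun f g => by
    filter_upwards [Lp.coeFn_add f (t • g), Lp.coeFn_smul t g] with x h1 h2
    rw [h1, Pi.add_apply, h2, Pi.smul_apply, smul_eq_mul]
  match k, w, v with
  | .integral, w, v =>
    exact hL2 (Ω' := Ω) (show H0s Ω s from w).1.1.fst (show H0s Ω s from v).1.1.fst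
  | .global, w, v =>
    exact ae_restrict_of_ae_restrict_of_subset (subset_univ Ω)
      (hL2 (show HTilde Ω s from w).1.1.fst (show HTilde Ω s from v).1.1.fst)
  | .spectral _ S, w, v => exact hL2 (HSpec.toL2 S s w) (HSpec.toL2 S s v)

/-- The space `W` is invariant under multiplication by test functions. -/
theorem exists_mul_testFunction (hd : 0 < d) (hΩ : IsOpen Ω) (hb : Bornology.IsBounded Ω)
    (hs : s ∈ Ioo (0 : ℝ) 1) {φ : E d → ℝ} (hφ : IsTestFunction Ω φ) {k : InnerChoice Ω}
    (w : W s k) :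
    ∃ v : W s k, ∀ᵐ x ∂((volume : Measure (E d)).restrict Ω), v.toFun x = φ x * w.toFun x := by
  match k, w with
  | .integral, w => exact exists_mul_H0s hd hs hφ w
  | .global, w =>
    obtain ⟨v, hv⟩ := exists_mul_HTilde hd hs hφ w
    exact ⟨v, ae_restrict_of_ae_restrict_of_subset (subset_univ Ω) hv⟩
  | .spectral _ S, w =>
    obtain ⟨v, hv, hvw⟩ := exists_mul_specSubmodule hd hΩ hb hs S hφ w.2
    exact ⟨⟨v, hv⟩, hvw⟩

end W

/-- Relative perturbations of a local minimizer do not change its support, so that the multiplier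
vanishes on them. -/
theorem IsMultiplier.apply_eq_zero {d : ℕ} {Ω : Set (E d)} {s : ℝ} {k : InnerChoice Ω}
    {F : W s k → ℝ} {α β : ℝ} (hβ : 0 < β) {w₀ : W s k} (hF : DifferentiableAt ℝ F w₀)
    (hw₀ : IsLocalMin (objective F α β) w₀) {lam : W s k →L[ℝ] ℝ}
    (hlam : IsMultiplier F α β w₀ lam) {g : E d → ℝ} {C : ℝ} (hg : ∀ x, ‖g x‖ ≤ C) {v : W s k}
    (hv : ∀ᵐ x ∂((volume : Measure (E d)).restrict Ω), v.toFun x = g x * w₀.toFun x) :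
    lam v = 0 := by
  have hline : HasDerivAt (fun t : ℝ => w₀ + t • v) v 0 := by
    simpa using ((hasDerivAt_id (0 : ℝ)).smul_const v).const_add w₀
  have hF' : HasDerivAt (fun t : ℝ => F (w₀ + t • v)) (fderiv ℝ F w₀ v) 0 := by
    have h : HasFDerivAt F (fderiv ℝ F w₀) (w₀ + (0 : ℝ) • v) := by
      simpa using hF.hasFDerivAt
    exact h.comp_hasDerivAt (0 : ℝ) hline
  have hN' : HasDerivAt (fun t : ℝ => α / 2 * ‖w₀ + t • v‖ ^ 2) (α * ⟪w₀, v⟫) 0 := by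
    have h := hline.norm_sq.const_mul (α / 2)
    simp only [zero_smul, add_zero] at h
    exact h.congr_deriv (by ring)
  have hmin : IsLocalMin (fun t : ℝ => F (w₀ + t • v) + α / 2 * ‖w₀ + t • v‖ ^ 2) 0 := by
    have htend : Tendsto (fun t : ℝ => w₀ + t • v) (𝓝 0) (𝓝 w₀) := by
      simpa using hline.continuousAt.tendsto
    -- This forces `|t g| < 1`, so the factor `1 + t g` never vanishes, for `t` of either sign.
    have hsmall : ∀ᶠ t : ℝ in 𝓝 0, |t| * (|C| + 1) < 1 := by
      have hc : Continuous fun t : ℝ => |t| * (|C| + 1) := by fun_prop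
      exact hc.continuousAt.eventually_lt_const (by simp)
    filter_upwards [htend.eventually hw₀, hsmall] with t ht hts
    have hint : ∫ x in Ω, absPowZero ((w₀ + t • v).toFun x) =
        ∫ x in Ω, absPowZero (w₀.toFun x) := by
      refine integral_congr_ae ?_
      filter_upwards [W.toFun_add_smul w₀ v t, hv] with x h1 h2
      have hne : 1 + t * g x ≠ 0 := by
        have h3 : |t * g x| < 1 := by
          rw [abs_mul]
          refine lt_of_le_of_lt (mul_le_mul_of_nonneg_left ?_ (abs_nonneg t)) hts
          have := (hg x).trans (le_abs_self C)
          rw [Real.norm_eq_abs] at this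
          linarith
        have := (abs_lt.1 h3).1
        linarith
      have h4 : (w₀ + t • v).toFun x = (1 + t * g x) * w₀.toFun x := by
        rw [h1, h2]
        ring
      simp only [absPowZero, h4, mul_eq_zero, hne, false_or]
    simp only [objective, hint] at ht
    simp only [zero_smul, add_zero]
    linarith
  have hzero := hmin.hasDerivAt_eq_zero (hF'.add hN')
  have hl := hlam v
  rw [hzero, zero_add] at hl
  exact (mul_eq_zero.1 hl).resolve_left hβ.ne'

theorem existsUnique_isMultiplier {V : Type} [NormedAddCommGroup V] [InnerProductSpace ℝ V]
    (F : V → ℝ) (α : ℝ) {β : ℝ} (hβ : β ≠ 0) (w : V) :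
    ∃! lam : V →L[ℝ] ℝ, IsMultiplier F α β w lam := by
  refine ⟨-(β⁻¹ • (fderiv ℝ F w + α • innerSL ℝ w)), fun v => ?_, fun lam hlam => ?_⟩
  · simp only [neg_apply, smul_apply, add_apply, innerSL_apply_apply,
      smul_eq_mul]
    field_simp
    ring
  · ext v
    have h := hlam v
    simp only [neg_apply, smul_apply, add_apply, innerSL_apply_apply,
      smul_eq_mul]
    field_simp
    linarith

end FracSob

end

theorem mainTheorem8 {d : ℕ} (hd : 0 < d) {Ω : Set (FracSob.E d)}
    (hΩ : FracSob.IsBoundedLipschitzDomain Ω)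
    {s : ℝ} (hs : s ∈ Set.Ioo (0 : ℝ) 1) (hs' : s ≠ 1 / 2)
    (k : FracSob.InnerChoice Ω)
    (F : FracSob.W s k → ℝ) (hF : FracSob.Admissible F)
    {α β : ℝ} (hα : 0 < α) (hβ : 0 < β)
    (w₀ : FracSob.W s k) (hw₀ : IsLocalMin (FracSob.objective F α β) w₀) :
    (∃! lam : FracSob.W s k →L[ℝ] ℝ, FracSob.IsMultiplier F α β w₀ lam) ∧
    ∀ lam : FracSob.W s k →L[ℝ] ℝ, FracSob.IsMultiplier F α β w₀ lam →
      0 ≤ lam w₀ ∧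
      ∀ φ : FracSob.E d → ℝ, FracSob.IsTestFunction Ω φ → (∀ x, 0 ≤ φ x) →
        ∃ v : FracSob.W s k,
          (∀ᵐ x ∂(MeasureTheory.volume.restrict Ω), v.toFun x = φ x * w₀.toFun x) ∧
          0 ≤ lam v := by
  have hdiff : DifferentiableAt ℝ F w₀ := hF.contDiff.differentiable one_ne_zero w₀
  refine ⟨FracSob.existsUnique_isMultiplier F α hβ.ne' w₀, fun lam hlam => ⟨?_, fun φ hφ _ => ?_⟩⟩
  -- The direction `w₀` is the relative perturbation with `g = 1`.
  · exact (hlam.apply_eq_zero hβ hdiff hw₀ (g := fun _ => 1) (C := 1) (fun x => by simp)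
      (Filter.Eventually.of_forall fun x => (one_mul _).symm)).ge
  · obtain ⟨v, hv⟩ := FracSob.W.exists_mul_testFunction hd hΩ.isOpen hΩ.isBounded hs hφ w₀
    obtain ⟨C, hC⟩ := hφ.exists_bound
    exact ⟨v, hv, (hlam.apply_eq_zero hβ hdiff hw₀ hC hv).ge⟩
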